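/- **Setting.** Let $\Sigma$ be a finite alphabet and $\mathcal X$ a finite set of variables with a distinguished variable $O\in\mathcal X$. A *copyless substitution* is a map $\sigma:\mathcal X\to(\mathcal X\cup\Sigma)^*$ such that no variable occurs twice in one image, nor in the images of two distinct variables; it is extended to $(\mathcal X\cup\Sigma)^*$ as a morphism that fixes the letters of $\Sigma$, and $(\sigma\circ\tau)(X)=\sigma(\tau(X))$. Let $\sigma_\varepsilon$ map every variable to the empty word. Let $\mathcal S$ be a finite set of copyless substitutions. * The *output* of $\lambda=\sigma_1\cdots\sigma_n\in\mathcal S^*$ is $\mathrm{out}(\lambda)=(\sigma_\varepsilon\circ\sigma_1\circ\cdots\circ\sigma_n)(O)\in\Sigma^*$. The *origin* $\mathrm{or}_\lambda(i)\in\{1,\dots,n\}$ of the output position $i$ is the index $t$ of the substitution $\sigma_t$ that produced the letter at position $i$; formally, it is the $i$th letter of the output of the sequence obtained by replacing every letter of $\Sigma$ occurring in the images of $\sigma_t$ by the number $t$, for all $t$. * For $j,t\in\mathbb N$ let $w_{j,t}(\lambda)$ be the number of positions $i\in\{1,\dots,\min(j,|\mathrm{out}(\lambda)|)\}$ with $\mathrm{or}_\lambda(i)\le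 t$. For $\lambda,\mu$ of the same length let $\mathrm{maxdiff}_j(\lambda,\mu)=\max_{1\le t\le|\lambda|}|w_{j,t}(\lambda)-w_{j,t}(\mu)|$. * The *primitive root* of a word $u$ is the shortest word $r$ with $u=r^m$ for some $m\ge 1$. For $\ell>0$, the *$\ell$-factorization* $u=u_1u_2\cdots u_p$ is determined from left to right: $u_i$ is the longest prefix of $u_iu_{i+1}\cdots u_p$ whose primitive root has length at most $\ell$, until $u$ is exhausted. The end positions of the factors are the *$\ell$-cuts* of $u$, and they form the set $\mathrm{cut}_\ell(u)$. * For $\lambda,\mu\in\mathcal S^*$ of the same length and with the same output, let $\mathrm{delay}_\ell(\lambda,\mu)=\max_{j\in\mathrm{cut}_\ell(\mathrm{out}(\lambda))}\mathrm{maxdiff}_j(\lambda,\mu)$ (with $\max\varnothing=0$). * The *delay resynchronizer* is $$\mathbb D_{k,\ell,\mathcal S}=\{(\lambda,\mu)\in\mathcal S^*\times\mathcal S^* : |\lambda|=|\mu|,\ \mathrm{out}(\lambda)=\mathrm{out}(\mu),\ \mathrm{delay}_\ell(\lambda,\mu)\le k\}.$$ A relation $R\subseteq\mathcal S^*\times\mathcal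 S^*$ is *letter-to-letter rational* if it is the set of (input, output) pairs of the accepting runs of some finite-state transducer each of whose transitions reads one letter and outputs exactly one letter. **Theorem.** For all integers $k\ge 0$ and $\ell>0$ and all $\mathcal X$, $O$, $\Sigma$, $\mathcal S$ as above, $\mathbb D_{k,\ell,\mathcal S}$ is letter-to-letter rational, and the set of convolutions $\{\lambda\otimes\mu : (\lambda,\mu)\in\mathbb D_{k,\ell,\mathcal S}\}$ is a regular subset of $(\mathcal S\times\mathcal S)^*$. Moreover, it is recognized by a (complete) DFA with a number of states doubly exponential in $\ell^3$ and in $|\mathcal X|$ and singly exponential in $k$: there is an absolute constant $c\in\mathbb N$, independent of $k,\ell,\mathcal X,O,\Sigma,\mathcal S$, such that a DFA with at most $$2^{\,(k+1)^c\,(|\Sigma|+2)^{\,c\,|\mathcal X|\,\ell^3}}$$ states always suffices. -/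

import Mathlib

universe u v

/-- A copyless substitution over variables `X` and alphabet `A`: a map from `X` to words over
`X ∪ A` such that no variable occurs twice in one image, nor in the images of two distinct
variables. -/
@[ext]
structure Substitution (X : Type u) (A : Type v) where
  /-- the image of a variable -/
  toFun : X → List (X ⊕ A)
  nodup : ∀ Y, ((toFun Y).filterMap Sum.getLeft?).Nodup
  disjoint : ∀ Y Z Z', Sum.inl Y ∈ toFun Z → Sum.inl Y ∈ toFun Z' → Z = Z'

namespace Substitution

variable {X : Type u} {A : Type v}

/-- The morphic extension of a substitution to words over `X ∪ A`: it fixes every letter of `A`.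
The composition `σ₁ ∘ σ₂` of substitutions is `Y ↦ σ₁.extend (σ₂.toFun Y)`. -/
def extend (σ : Substitution X A) (w : List (X ⊕ A)) : List (X ⊕ A) :=
  w.flatMap (Sum.elim σ.toFun (fun a => [Sum.inr a]))

/-- The substitution that maps every variable to the empty word. -/
def empty (X : Type u) (A : Type v) : Substitution X A where
  toFun _ := []
  nodup _ := by simp
  disjoint := by simp

/-- Replace every letter `a` in the images of `σ` by the letter `g a`. -/
def mapLetters {B : Type*} (g : A → B) (σ : Substitution X A) : Substitution X B where
  toFun Y := (σ.toFun Y).map (Sum.map id g)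
  nodup Y := by
    have h : (Sum.getLeft? ∘ Sum.map id g : X ⊕ A → Option X) = Sum.getLeft? := by
      funext x
      cases x <;> rfl
    rw [List.filterMap_map, h]
    exact σ.nodup Y
  disjoint Y Z Z' h h' := by
    simp only [List.mem_map, Sum.exists, Sum.map_inl, Sum.map_inr, id, Sum.inl.injEq,
      reduceCtorEq, and_false, exists_false, or_false, exists_eq_right] at h h'
    exact σ.disjoint Y Z Z' h h'

/-- The output `(σ_ε ∘ σ₁ ∘ ⋯ ∘ σₙ)(O)` of the sequence `σ₁ ⋯ σₙ`, where `σ_ε` erases all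
variables; the final `filterMap` only changes the type, as no variable is left. -/
def output (O : X) (s : List (Substitution X A)) : List A :=
  ((empty X A).extend (s.foldr extend [Sum.inl O])).filterMap Sum.getRight?

/-- The origins of the output letters of `s = σ₁ ⋯ σₙ`, in the order of the output: the output of
the sequence obtained by replacing every letter in `σₜ` by the number `t ∈ {1, …, n}`. -/
def origins (O : X) (s : List (Substitution X A)) : List ℕ :=
  output O (s.mapIdx (fun i σ => σ.mapLetters (fun _ => i + 1)))

/-- The number of output positions of `s` among the first `j` ones with origin at most `t`. -/
def weight (O : X) (j t : ℕ) (s : List (Substitution X A)) : ℕ :=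
  ((origins O s).take j).countP (fun o => decide (o ≤ t))

/-- The difference of the weights of `s` and `s'` at position `j` and time `t`. -/
def weightDiff (O : X) (j t : ℕ) (s s' : List (Substitution X A)) : ℕ :=
  ((weight O j t s : ℤ) - (weight O j t s' : ℤ)).natAbs

/-- The maximal weight difference at position `j`, over the times `1 ≤ t ≤ |s|`. -/
def maxDiff (O : X) (j : ℕ) (s s' : List (Substitution X A)) : ℕ :=
  (Finset.Icc 1 s.length).sup (fun t => weightDiff O j t s s')

end Substitution

section Factorization

variable {A : Type v}

/-- The primitive root of `w`: the shortest word `r` such that `w = r ^ n` for some `n > 0`. -/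
noncomputable def primitiveRoot (w : List A) : List A :=
  Function.argminOn List.length {r : List A | ∃ n : ℕ, 0 < n ∧ w = (List.replicate n r).flatten}
    ⟨w, 1, Nat.one_pos, by simp⟩

open Classical in
/-- The length of the longest prefix of `w` whose primitive root has length at most `l`. -/
noncomputable def factorLength (l : ℕ) (w : List A) : ℕ :=
  ((Finset.range (w.length + 1)).filter
    (fun n => (primitiveRoot (w.take n)).length ≤ l)).sup id

theorem factorLength_le (l : ℕ) (w : List A) : factorLength l w ≤ w.length := by
  unfold factorLength
  refine Finset.sup_le fun n hn => ?_
  have := (Finset.mem_filter.1 hn).1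
  exact Nat.lt_succ_iff.1 (Finset.mem_range.1 this)

/-- The `l`-factorization of `w`: from left to right, each factor is the longest prefix of the
remaining word whose primitive root has length at most `l`. For `l > 0` this prefix is non-empty
as long as the remaining word is, so that the recursion stops exactly at the end of `w`. -/
noncomputable def factors (l : ℕ) (w : List A) : List (List A) :=
  if factorLength l w = 0 then []
  else w.take (factorLength l w) :: factors l (w.drop (factorLength l w))
termination_by w.length
decreasing_by
  have := factorLength_le l w
  rw [List.length_drop]
  omega

/-- The `l`-cuts of `w`: the end positions of the factors in its `l`-factorization. -/
noncomputable def cuts (l : ℕ) (w : List A) : Finset ℕ :=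
  (Finset.range (factors l w).length).image
    (fun i => (((factors l w).take (i + 1)).map List.length).sum)

end Factorization

section Delay

variable {X : Type u} {A : Type v}

/-- The `l`-delay of two sequences of substitutions; it is meant for sequences of the same length
with the same output. The maximum over the empty set is `0`. -/
noncomputable def delay (O : X) (l : ℕ) (s s' : List (Substitution X A)) : ℕ :=
  (cuts l (Substitution.output O s)).sup (fun j => Substitution.maxDiff O j s s')

/-- The `(k, l, S)`-delay resynchronizer: the pairs of sequences over `S` of the same length, with
the same output, whose `l`-delay is at most `k`. -/
def delayResynchronizer (O : X) (k l : ℕ) (S : Finset (Substitution X A)) :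
    Set (List S × List S) :=
  {p | p.1.length = p.2.length ∧
    Substitution.output O (p.1.map Subtype.val) = Substitution.output O (p.2.map Subtype.val) ∧
    delay O l (p.1.map Subtype.val) (p.2.map Subtype.val) ≤ k}

end Delay

/-- A real-time transducer with states `Q` whose input and output alphabets are both `B`: an
automaton together with an output word for each of its transitions. -/
structure Transducer (B : Type u) (Q : Type v) where
  /-- the initial states -/
  initial : Set Q
  /-- the final states -/
  final : Set Q
  /-- the transitions -/
  trans : Set (Q × B × Q)
  /-- the output of a transition -/
  out : trans → List B

namespace Transducer

variable {B : Type u} {Q : Type v}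

/-- `T.Run p x y q`: there is a run of `T` from `p` to `q` with input `x` and output `y`. -/
inductive Run (T : Transducer B Q) : Q → List B → List B → Q → Prop
  | nil (q : Q) : Run T q [] [] q
  | cons {p q r : Q} {b : B} {x y : List B} (h : (p, b, q) ∈ T.trans) (hr : Run T q x y r) :
      Run T p (b :: x) (T.out ⟨(p, b, q), h⟩ ++ y) r

/-- The pairs (input, output) of the accepting runs of `T`. -/
def transduction (T : Transducer B Q) : Set (List B × List B) :=
  {p | ∃ q₀ ∈ T.initial, ∃ q ∈ T.final, T.Run q₀ p.1 p.2 q}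

/-- Every transition outputs exactly one letter. -/
def LetterToLetter (T : Transducer B Q) : Prop :=
  ∀ δ, (T.out δ).length = 1

end Transducer

/-- A relation on words is letter-to-letter rational if it is recognized by a letter-to-letter
transducer with finitely many states. -/
def IsLetterToLetterRational {B : Type u} (R : Set (List B × List B)) : Prop :=
  ∃ (Q : Type) (_ : Finite Q) (T : Transducer B Q), T.LetterToLetter ∧ T.transduction = R

/-- The language of the convolutions `x ⊗ y` of the pairs `(x, y) ∈ R`, for a relation `R` between
words of equal length. -/
def convolutionLanguage {B : Type u} (R : Set (List B × List B)) : Language (B × B) :=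
  {w | ∃ p ∈ R, w = p.1.zip p.2}

/-!
The complement of the delay resynchronizer is recognized by a nondeterministic automaton that
searches for a witness of a violation, and the automaton of the theorem is its complemented powerset
automaton.

*Witnesses.* Let `u` and `v` be the outputs of `s` and `s'`. If `(s, s')` violates the conditions,
then there is a cut `j` (or `j = 0`) up to which the two factorizations agree and the weights at `j`
differ by at most `k` at any time, while the next factors of `u` and `v` are different or the
weights at their ends differ by more than `k` at some time (`exists_isWitness_iff`). Conversely, let
a position `j` of `u` and a position `j'` of `v` be marked. If their weights differ by at most `k`
at any time and are finally equal, which a bounded counter can check, then `j = j'`. So a difference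
of the next factors proves that `u ≠ v`, and if they are equal, then an overflow of a second
counter, for their ends, proves that the delay exceeds `k`. No unbounded comparison of positions in
`u` and `v` is needed.

*Factors.* The `l`-factorization is followed from left to right with a finite `summary` of the part
of the current factor read so far (its first `l` letters, its length modulo `l!`, its periods of
length at most `l`) and a guess of the next `l` letters. This suffices: `summary` is a right
congruence that decides whether the primitive root is short, and if some longer prefix of the
remaining word has a short primitive root, then so has one that is longer by at most `l`
(`exists_shortRoot_take_le_add`). A factor is determined by its length and its summary
(`eq_of_summary_eq`).

*Substitutions.* The automaton reads `σ₁, σ₂, …`, which assemble the output from the contents of the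
variables. For every variable it guesses whether its content survives in the output and, if so, the
two states of the factor automaton at its ends. By copylessness a variable is used at most once, so
that one pair of states per variable is enough (`Realizes.exists_glue`), and the letters before a
marked position that are produced in one step are counted in this step (`pathWeight_glue_succ`).

The factor automaton has at most `b ^ (6 * l ^ 2)` states, where `b = |A| + 2`; this yields
`(k + 1) ^ 28 * b ^ (28 * |X| * l ^ 3)` states of the nondeterministic automaton.
-/

/-! ### Annotated outputs -/

namespace Substitution

variable {X : Type u} {A : Type v}

theorem extend_append (σ : Substitution X A) (w w' : List (X ⊕ A)) :
    σ.extend (w ++ w') = σ.extend w ++ σ.extend w' := by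
  simp [extend]

theorem foldr_extend_append (s : List (Substitution X A)) (w w' : List (X ⊕ A)) :
    s.foldr extend (w ++ w') = s.foldr extend w ++ s.foldr extend w' := by
  induction s with
  | nil => rfl
  | cons σ s ih => simp [ih, extend_append]

theorem foldr_extend_inr (s : List (Substitution X A)) (a : A) :
    s.foldr extend [Sum.inr a] = [Sum.inr a] := by
  induction s with
  | nil => rfl
  | cons σ s ih => simp [ih, extend]

theorem foldr_extend_nil (s : List (Substitution X A)) :
    s.foldr extend [] = ([] : List (X ⊕ A)) := by
  induction s with
  | nil => rfl
  | cons σ s ih => simp [ih, extend]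

theorem output_nil (Y : X) : output Y ([] : List (Substitution X A)) = [] := by
  simp [output, extend, empty]

/-- The output of a word over variables and letters is the concatenation of the outputs of its
symbols. -/
theorem filterMap_extend_foldr (s : List (Substitution X A)) (w : List (X ⊕ A)) :
    ((empty X A).extend (s.foldr extend w)).filterMap Sum.getRight? =
      w.flatMap (Sum.elim (fun Z => output Z s) (fun a => [a])) := by
  induction w with
  | nil => simp [foldr_extend_nil, extend]
  | cons x w ih =>
    rw [← List.singleton_append, foldr_extend_append, extend_append, List.filterMap_append, ih]
    cases x with
    | inl Z => simp [output]
    | inr a => simp [foldr_extend_inr, extend]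

theorem output_concat (Y : X) (s : List (Substitution X A)) (σ : Substitution X A) :
    output Y (s ++ [σ]) =
      (σ.toFun Y).flatMap (Sum.elim (fun Z => output Z s) (fun a => [a])) := by
  rw [← filterMap_extend_foldr]
  simp [output, extend]

/-- The output of `s` together with the origin of each of its letters. -/
def annotated (Y : X) (s : List (Substitution X A)) : List (A × ℕ) :=
  output Y (s.mapIdx fun i σ => σ.mapLetters fun a => (a, i + 1))

theorem annotated_nil (Y : X) : annotated Y ([] : List (Substitution X A)) = [] :=
  output_nil Y

theorem annotated_concat (Y : X) (s : List (Substitution X A)) (σ : Substitution X A) :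
    annotated Y (s ++ [σ]) = (σ.toFun Y).flatMap
      (Sum.elim (fun Z => annotated Z s) (fun a => [(a, s.length + 1)])) := by
  unfold annotated
  rw [List.mapIdx_concat, output_concat]
  simp only [mapLetters, List.flatMap_map]
  congr 1
  funext x
  cases x <;> rfl

theorem origins_concat (Y : X) (s : List (Substitution X A)) (σ : Substitution X A) :
    origins Y (s ++ [σ]) = (σ.toFun Y).flatMap
      (Sum.elim (fun Z => origins Z s) (fun _ => [s.length + 1])) := by
  unfold origins
  rw [List.mapIdx_concat, output_concat]
  simp only [mapLetters, List.flatMap_map]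
  congr 1
  funext x
  cases x <;> rfl

theorem map_fst_annotated (Y : X) (s : List (Substitution X A)) :
    (annotated Y s).map Prod.fst = output Y s := by
  induction s using List.reverseRecOn generalizing Y with
  | nil => simp [annotated_nil, output_nil]
  | append_singleton s σ ih =>
    rw [annotated_concat, output_concat, List.map_flatMap]
    congr 1
    funext x
    cases x <;> simp [ih]

theorem map_snd_annotated (Y : X) (s : List (Substitution X A)) :
    (annotated Y s).map Prod.snd = origins Y s := by
  induction s using List.reverseRecOn generalizing Y with
  | nil => simp [annotated_nil, origins, output_nil]
  | append_singleton s σ ih =>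
    rw [annotated_concat, origins_concat, List.map_flatMap]
    congr 1
    funext x
    cases x <;> simp [ih]

theorem le_length_of_mem_origins {Y : X} {s : List (Substitution X A)} {o : ℕ}
    (h : o ∈ origins Y s) : 1 ≤ o ∧ o ≤ s.length := by
  induction s using List.reverseRecOn generalizing Y with
  | nil => simp [origins, output_nil] at h
  | append_singleton s σ ih =>
    rw [origins_concat, List.mem_flatMap] at h
    obtain ⟨x, -, hx⟩ := h
    rw [List.length_append, List.length_singleton]
    cases x with
    | inl Z => have := ih hx; omega
    | inr a =>
      simp only [Sum.elim_inr, List.mem_singleton] at hx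
      omega

theorem length_origins (Y : X) (s : List (Substitution X A)) :
    (origins Y s).length = (output Y s).length := by
  rw [← map_snd_annotated, ← map_fst_annotated, List.length_map, List.length_map]

end Substitution

/-! ### Runs on the output of a sequence of substitutions -/

/-- `IsPath Δ p w q`: the word `w` labels a path from `p` to `q` in the transition relation `Δ`. -/
def IsPath {Q : Type*} {B : Type*} (Δ : Q → B → Q → Prop) : Q → List B → Q → Prop
  | p, [], q => p = q
  | p, b :: w, q => ∃ r, Δ p b r ∧ IsPath Δ r w q

theorem isPath_append {Q B : Type*} {Δ : Q → B → Q → Prop} {p q : Q} {w w' : List B} :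
    IsPath Δ p (w ++ w') q ↔ ∃ r, IsPath Δ p w r ∧ IsPath Δ r w' q := by
  induction w generalizing p with
  | nil => simp [IsPath]
  | cons b w ih =>
    simp only [List.cons_append, IsPath, ih]
    grind

namespace Substitution

variable {X : Type u} {A : Type v} {Q G : Type*} (Δ : Q → G → Q → Prop) (π : G → A)

/-- The transition relation on variables and letters in which a variable `Z` leads from `p` to `q`
if `ρ Z = some (p, q)`. -/
def extendTrans (ρ : X → Option (Q × Q)) : Q → X ⊕ G → Q → Prop :=
  fun p x q => Sum.elim (fun Z => ρ Z = some (p, q)) (fun g => Δ p g q) x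

/-- The family `w` of paths realizes `ρ` after `s`: for every variable `Y` with
`ρ Y = some (p, q)`, the word `w Y` is the annotated output of `Y` with its letters lifted along
`π`, and it labels a path from `p` to `q`. The variables with `ρ Y = none` are those whose content
will be lost; they carry the empty path. -/
structure Realizes (s : List (Substitution X A)) (ρ : X → Option (Q × Q))
    (w : X → List (G × ℕ)) : Prop where
  map_eq : ∀ Y p q, ρ Y = some (p, q) → (w Y).map (Prod.map π id) = annotated Y s
  isPath : ∀ Y p q, ρ Y = some (p, q) → IsPath Δ p ((w Y).map Prod.fst) q
  eq_nil : ∀ Y, ρ Y = none → w Y = []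

/-- One step of the guess of endpoints of paths: `m Y` lifts the image of `Y` under `σ` and labels a
path between the endpoints `ρ' Y`, in which a variable `Z` stands for a path between the endpoints
`ρ Z`. A variable is guessed to survive before the step only if it is used in the step. -/
structure GuessStep (ρ : X → Option (Q × Q)) (σ : Substitution X A) (ρ' : X → Option (Q × Q))
    (m : X → List (X ⊕ G)) : Prop where
  map_eq : ∀ Y p q, ρ' Y = some (p, q) → (m Y).map (Sum.map id π) = σ.toFun Y
  isPath : ∀ Y p q, ρ' Y = some (p, q) → IsPath (extendTrans Δ ρ) p (m Y) q
  eq_nil : ∀ Y, ρ' Y = none → m Y = []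
  used : ∀ Z, ρ Z ≠ none → ∃ Y, Sum.inl Z ∈ m Y

/-- The paths obtained from the paths `w` by one step `m`, performed at time `n + 1`. -/
def glue (m : X → List (X ⊕ G)) (w : X → List (G × ℕ)) (n : ℕ) (Y : X) : List (G × ℕ) :=
  (m Y).flatMap (Sum.elim w fun g => [(g, n + 1)])

variable {Δ π}

theorem _root_.IsPath.flatMap {ρ : X → Option (Q × Q)} {w : X → List (G × ℕ)} {n : ℕ}
    (hw : ∀ Z p q, ρ Z = some (p, q) → IsPath Δ p ((w Z).map Prod.fst) q)
    {x : List (X ⊕ G)} {p q : Q} (h : IsPath (extendTrans Δ ρ) p x q) :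
    IsPath Δ p ((x.flatMap (Sum.elim w fun g => [(g, n + 1)])).map Prod.fst) q := by
  induction x generalizing p with
  | nil => exact h
  | cons y x ih =>
    obtain ⟨r, hr, h⟩ := h
    rw [List.flatMap_cons, List.map_append, isPath_append]
    refine ⟨r, ?_, ih h⟩
    cases y with
    | inl Z => exact hw Z p r hr
    | inr g => exact ⟨r, hr, rfl⟩

theorem _root_.IsPath.ne_none {ρ : X → Option (Q × Q)} {x : List (X ⊕ G)} {p q : Q}
    (h : IsPath (extendTrans Δ ρ) p x q) {Z : X} (hZ : Sum.inl Z ∈ x) : ρ Z ≠ none := by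
  induction x generalizing p with
  | nil => simp at hZ
  | cons y x ih =>
    obtain ⟨r, hr, h⟩ := h
    rcases List.mem_cons.1 hZ with rfl | hZ
    · intro h'
      simp [extendTrans, h'] at hr
    · exact ih h hZ

theorem _root_.IsPath.congr {ρ ρ' : X → Option (Q × Q)} {x : List (X ⊕ G)} {p q : Q}
    (h : IsPath (extendTrans Δ ρ) p x q) (hρ : ∀ Z, Sum.inl Z ∈ x → ρ Z = ρ' Z) :
    IsPath (extendTrans Δ ρ') p x q := by
  induction x generalizing p with
  | nil => exact h
  | cons y x ih =>
    obtain ⟨r, hr, h⟩ := h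
    refine ⟨r, ?_, ih h fun Z hZ => hρ Z (List.mem_cons_of_mem _ hZ)⟩
    cases y with
    | inl Z => exact (hρ Z List.mem_cons_self).symm.trans hr
    | inr g => exact hr

theorem filterMap_getLeft?_inl {B : Type*} (Y : X) (x : List (X ⊕ B)) :
    (Sum.inl Y :: x).filterMap Sum.getLeft? = Y :: x.filterMap Sum.getLeft? := by
  simp

theorem filterMap_getLeft?_inr {B : Type*} (b : B) (x : List (X ⊕ B)) :
    (Sum.inr b :: x).filterMap Sum.getLeft? = x.filterMap Sum.getLeft? := by
  simp [List.filterMap_cons]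

theorem inl_mem_of_map_eq {x : List (X ⊕ G)} {y : List (X ⊕ A)}
    (h : x.map (Sum.map id π) = y) (Z : X) : Sum.inl Z ∈ x ↔ Sum.inl Z ∈ y := by
  subst h
  simp

theorem Realizes.concat {s : List (Substitution X A)} {ρ ρ' : X → Option (Q × Q)}
    {w : X → List (G × ℕ)} {σ : Substitution X A} {m : X → List (X ⊕ G)}
    (hw : Realizes Δ π s ρ w) (hm : GuessStep Δ π ρ σ ρ' m) :
    Realizes Δ π (s ++ [σ]) ρ' (glue m w s.length) where
  map_eq Y p q h := by
    rw [annotated_concat, ← hm.map_eq Y p q h, List.flatMap_map, glue,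
      List.map_flatMap]
    refine List.flatMap_congr fun x hx => ?_
    cases x with
    | inr g => rfl
    | inl Z =>
      obtain ⟨⟨p', q'⟩, h'⟩ := Option.ne_none_iff_exists'.1 ((hm.isPath Y p q h).ne_none hx)
      exact hw.map_eq Z p' q' h'
  isPath Y p q h := (hm.isPath Y p q h).flatMap hw.isPath
  eq_nil Y h := by simp [glue, hm.eq_nil Y h]

/-- A path on the annotated output of a word without repeated variables splits into paths on the
annotated outputs of its variables. -/
theorem exists_split_path (val : X → List (A × ℕ)) (n : ℕ) (x : List (X ⊕ A))
    (hx : (x.filterMap Sum.getLeft?).Nodup) (z : List (G × ℕ)) (p q : Q)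
    (hz : z.map (Prod.map π id) = x.flatMap (Sum.elim val fun a => [(a, n + 1)]))
    (h : IsPath Δ p (z.map Prod.fst) q) :
    ∃ (ρ : X → Option (Q × Q)) (w : X → List (G × ℕ)) (m : List (X ⊕ G)),
      m.map (Sum.map id π) = x ∧ IsPath (extendTrans Δ ρ) p m q ∧
      z = m.flatMap (Sum.elim w fun g => [(g, n + 1)]) ∧
      ∀ Z, Sum.inl Z ∈ x → ∀ p q, ρ Z = some (p, q) →
        (w Z).map (Prod.map π id) = val Z ∧ IsPath Δ p ((w Z).map Prod.fst) q := by
  classical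
  induction x generalizing z p with
  | nil =>
    obtain rfl : z = [] := by simpa using hz
    exact ⟨fun _ => none, fun _ => [], [], rfl, h, rfl, by simp⟩
  | cons y x ih =>
    rw [List.flatMap_cons] at hz
    obtain ⟨z₁, z₂, rfl, hz₁, hz₂⟩ := List.map_eq_append_iff.1 hz
    rw [List.map_append, isPath_append] at h
    obtain ⟨r, h₁, h₂⟩ := h
    cases y with
    | inr a =>
      obtain ⟨ρ, w, m, rfl, hm, rfl, hρ⟩ := ih (by rwa [filterMap_getLeft?_inr] at hx) z₂ r hz₂ h₂
      obtain ⟨⟨g, o⟩, rfl, hg⟩ := List.map_eq_singleton_iff.1 hz₁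
      obtain ⟨rfl, rfl⟩ := Prod.mk.inj hg
      obtain ⟨r', hr', rfl⟩ := h₁
      exact ⟨ρ, w, Sum.inr g :: m, by simp, ⟨_, hr', hm⟩, by simp, by simpa using hρ⟩
    | inl Y =>
      rw [filterMap_getLeft?_inl, List.nodup_cons] at hx
      obtain ⟨ρ, w, m, rfl, hm, rfl, hρ⟩ := ih hx.2 z₂ r hz₂ h₂
      have hY : ∀ Z, Sum.inl Z ∈ m → Z ≠ Y := by
        rintro Z hZ rfl
        exact hx.1 (List.mem_filterMap.2 ⟨Sum.inl Z, (inl_mem_of_map_eq rfl Z).1 hZ, rfl⟩)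
      -- `Y` does not occur in the rest, so that its endpoints can be set without a conflict.
      refine ⟨Function.update ρ Y (some (p, r)), Function.update w Y z₁, Sum.inl Y :: m, by simp,
        ⟨r, by simp [extendTrans], hm.congr fun Z hZ => by simp [hY Z hZ]⟩, ?_, ?_⟩
      · rw [List.flatMap_cons]
        congr 1
        · simp
        · refine List.flatMap_congr fun t ht => ?_
          cases t with
          | inr g => rfl
          | inl Z => simp [hY Z ht]
      · intro Z hZ p' q' h'
        by_cases hZY : Z = Y
        · subst hZY
          simp only [Function.update_self, Option.some.injEq, Prod.mk.injEq] at h' ⊢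
          obtain ⟨rfl, rfl⟩ := h'
          exact ⟨hz₁, h₁⟩
        · simp only [Function.update_of_ne hZY] at h' ⊢
          refine hρ Z ?_ p' q' h'
          simpa [hZY] using hZ

/-- Every family of paths after `s ++ [σ]` arises from a family after `s` by one step. Copylessness
makes the endpoints of the path of a variable well defined: a variable occurs at most once in all
the images of `σ`. -/
theorem Realizes.exists_glue {s : List (Substitution X A)} {ρ' : X → Option (Q × Q)}
    {w' : X → List (G × ℕ)} {σ : Substitution X A} (hw' : Realizes Δ π (s ++ [σ]) ρ' w') :
    ∃ ρ w m, Realizes Δ π s ρ w ∧ GuessStep Δ π ρ σ ρ' m ∧ w' = glue m w s.length := by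
  classical
  have key : ∀ Y, ∃ (ρ : X → Option (Q × Q)) (w : X → List (G × ℕ)) (m : List (X ⊕ G)),
      (ρ' Y = none → m = []) ∧ ∀ p q, ρ' Y = some (p, q) →
      m.map (Sum.map id π) = σ.toFun Y ∧ IsPath (extendTrans Δ ρ) p m q ∧
      w' Y = m.flatMap (Sum.elim w fun g => [(g, s.length + 1)]) ∧
      ∀ Z, Sum.inl Z ∈ σ.toFun Y → ∀ p q, ρ Z = some (p, q) →
        (w Z).map (Prod.map π id) = annotated Z s ∧ IsPath Δ p ((w Z).map Prod.fst) q := by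
    intro Y
    cases hY : ρ' Y with
    | none => exact ⟨fun _ => none, fun _ => [], [], by simp, by simp⟩
    | some pq =>
      obtain ⟨p, q⟩ := pq
      obtain ⟨ρ, w, m, h⟩ := exists_split_path (fun Z => annotated Z s) s.length (σ.toFun Y)
        (σ.nodup Y) (w' Y) p q ((hw'.map_eq Y p q hY).trans (annotated_concat Y s σ))
        (hw'.isPath Y p q hY)
      refine ⟨ρ, w, m, by simp, fun p' q' h' => ?_⟩
      obtain ⟨rfl, rfl⟩ := Prod.mk.inj (Option.some.inj h')
      exact h
  choose R W m hnone hsome using key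
  have hmem : ∀ Y Z, Sum.inl Z ∈ m Y → ρ' Y ≠ none ∧ Sum.inl Z ∈ σ.toFun Y := by
    intro Y Z hZ
    cases hY : ρ' Y with
    | none => simp [hnone Y hY] at hZ
    | some pq => exact ⟨by simp, (inl_mem_of_map_eq (hsome Y _ _ hY).1 Z).1 hZ⟩
  -- The endpoints of `Z` are those found in the unique image in which `Z` occurs.
  let ρ : X → Option (Q × Q) := fun Z =>
    if h : ∃ Y, Sum.inl Z ∈ m Y then R h.choose Z else none
  let w : X → List (G × ℕ) := fun Z =>
    if h : ∃ Y, Sum.inl Z ∈ m Y then W h.choose Z else []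
  have hpar : ∀ Y Z, Sum.inl Z ∈ m Y → ρ Z = R Y Z ∧ w Z = W Y Z := by
    intro Y Z hZ
    have h : ∃ Y, Sum.inl Z ∈ m Y := ⟨Y, hZ⟩
    have hY : h.choose = Y :=
      σ.disjoint Z _ _ (hmem _ _ h.choose_spec).2 (hmem _ _ hZ).2
    simp only [ρ, w, dif_pos h, hY, and_self]
  have hRealized : ∀ Z p q, ρ Z = some (p, q) →
      (w Z).map (Prod.map π id) = annotated Z s ∧ IsPath Δ p ((w Z).map Prod.fst) q := by
    intro Z p q h
    by_cases hZ : ∃ Y, Sum.inl Z ∈ m Y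
    · obtain ⟨Y, hY⟩ := hZ
      obtain ⟨h₁, h₂⟩ := hpar Y Z hY
      rw [h₁] at h
      rw [h₂]
      obtain ⟨hne, hmem⟩ := hmem Y Z hY
      obtain ⟨⟨p', q'⟩, h'⟩ := Option.ne_none_iff_exists'.1 hne
      exact (hsome Y p' q' h').2.2.2 Z hmem p q h
    · simp [ρ, hZ] at h
  refine ⟨ρ, w, m, ⟨fun Z p q h => (hRealized Z p q h).1, fun Z p q h => (hRealized Z p q h).2,
    fun Z h => ?_⟩, ⟨fun Y p q h => (hsome Y p q h).1, fun Y p q h => ?_, hnone, fun Z h => ?_⟩, ?_⟩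
  · by_cases hZ : ∃ Y, Sum.inl Z ∈ m Y
    · obtain ⟨Y, hY⟩ := hZ
      obtain ⟨hne, -⟩ := hmem Y Z hY
      obtain ⟨⟨p', q'⟩, h'⟩ := Option.ne_none_iff_exists'.1 hne
      exact absurd ((hpar Y Z hY).1.symm.trans h) ((hsome Y p' q' h').2.1.ne_none hY)
    · simp [w, hZ]
  · exact (hsome Y p q h).2.1.congr fun Z hZ => (hpar Y Z hZ).1.symm
  · by_contra hZ
    simp [ρ, hZ] at h
  · funext Y
    cases hY : ρ' Y with
    | none => simp [glue, hnone Y hY, hw'.eq_nil Y hY]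
    | some pq =>
      rw [(hsome Y _ _ hY).2.2.1, glue]
      refine List.flatMap_congr fun t ht => ?_
      cases t with
      | inr g => rfl
      | inl Z => exact (hpar Y Z ht).2.symm

theorem Realizes.mem_origins {s : List (Substitution X A)} {ρ : X → Option (Q × Q)}
    {w : X → List (G × ℕ)} (hw : Realizes Δ π s ρ w) {Y : X} {g : G × ℕ} (h : g ∈ w Y) :
    g.2 ∈ origins Y s := by
  cases hY : ρ Y with
  | none => simp [hw.eq_nil Y hY] at h
  | some pq =>
    rw [← map_snd_annotated, ← hw.map_eq Y _ _ hY, List.map_map]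
    exact List.mem_map.2 ⟨g, h, rfl⟩

theorem GuessStep.nodup {ρ ρ' : X → Option (Q × Q)} {σ : Substitution X A} {m : X → List (X ⊕ G)}
    (hm : GuessStep Δ π ρ σ ρ' m) (Y : X) : ((m Y).filterMap Sum.getLeft?).Nodup := by
  cases hY : ρ' Y with
  | none => simp [hm.eq_nil Y hY]
  | some pq =>
    have h := σ.nodup Y
    rw [← hm.map_eq Y _ _ hY, List.filterMap_map] at h
    convert h using 2 with x
    cases x <;> rfl

theorem GuessStep.mem {ρ ρ' : X → Option (Q × Q)} {σ : Substitution X A} {m : X → List (X ⊕ G)}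
    (hm : GuessStep Δ π ρ σ ρ' m) {Y Z : X} (hZ : Sum.inl Z ∈ m Y) :
    Sum.inl Z ∈ σ.toFun Y := by
  cases hY : ρ' Y with
  | none => simp [hm.eq_nil Y hY] at hZ
  | some pq => exact (inl_mem_of_map_eq (hm.map_eq Y _ _ hY) Z).1 hZ

/-! ### Weights of families of paths -/

theorem countP_glue (P : G × ℕ → Bool) (m : X → List (X ⊕ G)) (w : X → List (G × ℕ)) (n : ℕ)
    (Y : X) : (glue m w n Y).countP P =
      (((m Y).filterMap Sum.getLeft?).map fun Z => (w Z).countP P).sum +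
        (m Y).countP (Sum.elim (fun _ => false) fun g => P (g, n + 1)) := by
  unfold glue
  induction m Y with
  | nil => rfl
  | cons y x ih =>
    rw [List.flatMap_cons, List.countP_append, ih]
    cases y with
    | inl Z => simp [add_assoc]
    | inr g => cases h : P (g, n + 1) <;> simp [filterMap_getLeft?_inr, h]; omega

variable [Fintype X]

/-- The number of letters in the paths `w` that satisfy `P` and have origin at most `t`. -/
def pathWeight (P : G → Bool) (w : X → List (G × ℕ)) (t : ℕ) : ℕ :=
  ∑ Y, (w Y).countP fun g => P g.1 && decide (g.2 ≤ t)

/-- The number of letters satisfying `P` that are produced in the step `m`. -/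
def stepWeight (P : G → Bool) (m : X → List (X ⊕ G)) : ℕ :=
  ∑ Y, (m Y).countP (Sum.elim (fun _ => false) P)

theorem sum_countP_glue {s : List (Substitution X A)} {ρ ρ' : X → Option (Q × Q)}
    {w : X → List (G × ℕ)} {σ : Substitution X A} {m : X → List (X ⊕ G)}
    (hw : Realizes Δ π s ρ w) (hm : GuessStep Δ π ρ σ ρ' m) (P : G × ℕ → Bool) (n : ℕ) :
    ∑ Y, (glue m w n Y).countP P = ∑ Z, (w Z).countP P +
      ∑ Y, (m Y).countP (Sum.elim (fun _ => false) fun g => P (g, n + 1)) := by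
  classical
  simp only [countP_glue, Finset.sum_add_distrib]
  congr 1
  have h : ∀ Y, (((m Y).filterMap Sum.getLeft?).map fun Z => (w Z).countP P).sum =
      ∑ Z, if Sum.inl Z ∈ m Y then (w Z).countP P else 0 := by
    intro Y
    rw [← List.sum_toFinset _ (hm.nodup Y), ← Finset.sum_filter]
    refine Finset.sum_congr ?_ fun _ _ => rfl
    ext Z
    simp
  simp only [h]
  rw [Finset.sum_comm]
  refine Finset.sum_congr rfl fun Z _ => ?_
  cases hZ : ρ Z with
  | none => simp [hw.eq_nil Z hZ]
  | some pq =>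
    obtain ⟨Y, hY⟩ := hm.used Z (by simp [hZ])
    rw [Finset.sum_eq_single Y, if_pos hY]
    · intro Y' _ hne
      rw [if_neg fun hY' => hne (σ.disjoint Z _ _ (hm.mem hY') (hm.mem hY))]
    · simp

theorem pathWeight_glue_of_le {s : List (Substitution X A)} {ρ ρ' : X → Option (Q × Q)}
    {w : X → List (G × ℕ)} {σ : Substitution X A} {m : X → List (X ⊕ G)}
    (hw : Realizes Δ π s ρ w) (hm : GuessStep Δ π ρ σ ρ' m) (P : G → Bool) {t : ℕ}
    (ht : t ≤ s.length) : pathWeight P (glue m w s.length) t = pathWeight P w t := by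
  unfold pathWeight
  rw [sum_countP_glue hw hm]
  have h : ¬ s.length + 1 ≤ t := by omega
  have : (Sum.elim (fun _ => false) fun _ => false : X ⊕ G → Bool) = fun _ => false := by
    funext x
    cases x <;> rfl
  simp [h, this]

theorem pathWeight_glue_succ {s : List (Substitution X A)} {ρ ρ' : X → Option (Q × Q)}
    {w : X → List (G × ℕ)} {σ : Substitution X A} {m : X → List (X ⊕ G)}
    (hw : Realizes Δ π s ρ w) (hm : GuessStep Δ π ρ σ ρ' m) (P : G → Bool) :
    pathWeight P (glue m w s.length) (s.length + 1) =
      pathWeight P w s.length + stepWeight P m := by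
  unfold pathWeight stepWeight
  rw [sum_countP_glue hw hm]
  congr 1
  · refine Finset.sum_congr rfl fun Y _ => List.countP_congr fun g hg => ?_
    have h := (le_length_of_mem_origins (hw.mem_origins hg)).2
    have h' : g.2 ≤ s.length + 1 := by omega
    simp [h, h']
  · simp

end Substitution

/-! ### Words with a short primitive root -/

section ShortRoot

variable {A : Type v} {l p : ℕ} {x x' : List A}

/-- The primitive root of `x` has length at most `l`. -/
def ShortRoot (l : ℕ) (x : List A) : Prop :=
  (primitiveRoot x).length ≤ l

/-- `x` is a prefix of a power of its prefix of length `p`; the condition is void if `p = 0` or if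
`x` has length at most `p`. -/
def IsPeriod (p : ℕ) (x : List A) : Prop :=
  ∀ i < x.length, x[i]? = x[i % p]?

theorem IsPeriod.take (h : IsPeriod p x) (n : ℕ) : IsPeriod p (x.take n) := by
  intro i hi
  rw [List.length_take, lt_min_iff] at hi
  have := Nat.mod_le i p
  rw [List.getElem?_take_of_lt hi.1, List.getElem?_take_of_lt (by omega), h i hi.2]

theorem isPeriod_concat {a : A} :
    IsPeriod p (x ++ [a]) ↔ IsPeriod p x ∧ (x ++ [a])[x.length % p]? = some a := by
  constructor
  · refine fun h => ⟨by simpa using h.take x.length, ?_⟩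
    rw [← h x.length (by simp)]
    simp
  · rintro ⟨h, ha⟩ i hi
    rw [List.length_append, List.length_singleton] at hi
    rcases Nat.lt_succ_iff_lt_or_eq.1 hi with hi | rfl
    · have := Nat.mod_le i p
      rw [List.getElem?_append_left hi, List.getElem?_append_left (by omega), h i hi]
    · rw [ha]
      simp

theorem getElem?_flatten_replicate (r : List A) (n i : ℕ) (hi : i < n * r.length) :
    (List.replicate n r).flatten[i]? = r[i % r.length]? := by
  induction n generalizing i with
  | zero => simp at hi
  | succ n ih =>
    rw [List.replicate_succ, List.flatten_cons]
    rcases lt_or_ge i r.length with h | h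
    · rw [List.getElem?_append_left h, Nat.mod_eq_of_lt h]
    · rw [List.getElem?_append_right h, ih _ (by rw [Nat.succ_mul] at hi; omega),
        Nat.mod_eq_sub_mod h]

theorem shortRoot_iff_exists_power :
    ShortRoot l x ↔ ∃ r : List A, r.length ≤ l ∧ ∃ n, 0 < n ∧ x = (List.replicate n r).flatten := by
  constructor
  · intro h
    exact ⟨_, h, Function.argminOn_mem List.length
      {r : List A | ∃ n : ℕ, 0 < n ∧ x = (List.replicate n r).flatten} _⟩
  · rintro ⟨r, hr, hx⟩
    exact (Function.argminOn_le List.length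
      {r : List A | ∃ n : ℕ, 0 < n ∧ x = (List.replicate n r).flatten} hx).trans hr

theorem shortRoot_iff (hl : 0 < l) :
    ShortRoot l x ↔ ∃ p, 0 < p ∧ p ≤ l ∧ p ∣ x.length ∧ IsPeriod p x := by
  rw [shortRoot_iff_exists_power]
  constructor
  · rintro ⟨r, hr, n, hn, rfl⟩
    rcases Nat.eq_zero_or_pos r.length with h | h
    · obtain rfl := List.length_eq_zero_iff.1 h
      exact ⟨1, one_pos, hl, by simp, fun i hi => by simp at hi⟩
    · refine ⟨r.length, h, hr, by simp, fun i hi => ?_⟩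
      rw [List.length_flatten, List.map_replicate, List.sum_replicate, smul_eq_mul] at hi
      have := Nat.mod_le i r.length
      rw [getElem?_flatten_replicate r n i hi,
        getElem?_flatten_replicate r n _ (by omega), Nat.mod_mod]
  · rintro ⟨p, hp, hpl, ⟨n, hn⟩, hx⟩
    rcases Nat.eq_zero_or_pos n with rfl | hn0
    · obtain rfl : x = [] := by simpa using hn
      exact ⟨[], by simp, 1, one_pos, by simp⟩
    · have hpx : p ≤ x.length := by
        rw [hn]
        exact Nat.le_mul_of_pos_right p hn0
      have hlen : (x.take p).length = p := by simpa using hpx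
      refine ⟨x.take p, by omega, n, hn0, List.ext_getElem? fun i => ?_⟩
      rcases lt_or_ge i x.length with hi | hi
      · rw [getElem?_flatten_replicate _ _ _ (by rwa [hlen, mul_comm, ← hn]), hlen, hx i hi,
          List.getElem?_take_of_lt (Nat.mod_lt _ hp)]
      · rw [List.getElem?_eq_none hi, List.getElem?_eq_none]
        rw [List.length_flatten, List.map_replicate, List.sum_replicate, smul_eq_mul, hlen,
          mul_comm, ← hn]
        exact hi

theorem shortRoot_nil (hl : 0 < l) : ShortRoot l ([] : List A) :=
  (shortRoot_iff hl).2 ⟨1, one_pos, hl, by simp, fun i hi => by simp at hi⟩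

/-- Prefixes with a short primitive root have no large gaps: dropping one copy of the root of such a
prefix gives a shorter one. Hence a bounded lookahead decides whether a factor can be extended. -/
theorem exists_shortRoot_take_le_add (hl : 0 < l) {m n : ℕ} (hmn : m < n) (hn : n ≤ x.length)
    (h : ShortRoot l (x.take n)) :
    ∃ n', m < n' ∧ n' ≤ m + l ∧ n' ≤ x.length ∧ ShortRoot l (x.take n') := by
  induction n using Nat.strong_induction_on with
  | _ n ih =>
    rcases le_or_gt n (m + l) with hnl | hnl
    · exact ⟨n, hmn, hnl, hn, h⟩
    -- Otherwise one copy of the root, of length `p ≤ l`, can be dropped.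
    · obtain ⟨p, hp, hpl, hdvd, hper⟩ := (shortRoot_iff hl).1 h
      refine ih (n - p) (by omega) (by omega) (by omega) ((shortRoot_iff hl).2
        ⟨p, hp, hpl, ?_, ?_⟩)
      · rw [List.length_take, min_eq_left hn] at hdvd
        rw [List.length_take, min_eq_left (by omega)]
        exact Nat.dvd_sub hdvd dvd_rfl
      · simpa [List.take_take] using hper.take (n - p)

theorem shortRoot_take_factorLength (hl : 0 < l) (x : List A) :
    ShortRoot l (x.take (factorLength l x)) := by
  classical
  obtain ⟨n, hn, h⟩ := Finset.exists_mem_eq_sup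
    ((Finset.range (x.length + 1)).filter fun n => (primitiveRoot (x.take n)).length ≤ l)
    ⟨0, Finset.mem_filter.2 ⟨by simp, shortRoot_nil hl⟩⟩ id
  unfold factorLength
  rw [h]
  exact (Finset.mem_filter.1 hn).2

theorem le_factorLength {n : ℕ} (hn : n ≤ x.length) (h : ShortRoot l (x.take n)) :
    n ≤ factorLength l x := by
  classical
  exact Finset.le_sup (f := id)
    (Finset.mem_filter.2 ⟨Finset.mem_range.2 (Nat.lt_succ_of_le hn), h⟩)

theorem factorLength_pos (hl : 0 < l) (hx : x ≠ []) : 0 < factorLength l x := by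
  have hx' := List.length_pos_iff.2 hx
  refine le_factorLength (n := 1) hx' ((shortRoot_iff hl).2 ⟨1, one_pos, hl, by simp, ?_⟩)
  intro i hi
  obtain rfl : i = 0 := by
    rw [List.length_take] at hi
    omega
  rfl

end ShortRoot

/-! ### Cuts -/

section Cuts

variable {A : Type v} {l : ℕ} {x : List A}

/-- The positions reached by the `l`-factorization of `x`: `0` and the `l`-cuts. -/
inductive IsCutPos (l : ℕ) (x : List A) : ℕ → Prop
  | zero : IsCutPos l x 0
  | next {j : ℕ} : IsCutPos l x j → j < x.length → IsCutPos l x (j + factorLength l (x.drop j))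

theorem IsCutPos.le {j : ℕ} (h : IsCutPos l x j) : j ≤ x.length := by
  cases h with
  | zero => exact Nat.zero_le _
  | @next j _ hj =>
    have := factorLength_le l (x.drop j)
    rw [List.length_drop] at this
    omega

theorem IsCutPos.cons {j : ℕ} (hx : x ≠ []) (h : IsCutPos l (x.drop (factorLength l x)) j) :
    IsCutPos l x (factorLength l x + j) := by
  induction h with
  | zero => simpa using IsCutPos.next (l := l) (x := x) .zero (List.length_pos_iff.2 hx)
  | @next j _ hj ih =>
    rw [List.length_drop] at hj
    rw [List.drop_drop, ← add_assoc]
    exact ih.next (by omega)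

theorem IsCutPos.exists_eq_add {j : ℕ} (h : IsCutPos l x j) :
    j = 0 ∨ x ≠ [] ∧ ∃ j', IsCutPos l (x.drop (factorLength l x)) j' ∧
      j = factorLength l x + j' := by
  induction h with
  | zero => exact Or.inl rfl
  | @next j _ hj ih =>
    refine Or.inr ⟨List.length_pos_iff.1 (by omega), ?_⟩
    rcases ih with rfl | ⟨-, j', hj', rfl⟩
    · exact ⟨0, .zero, by simp⟩
    · refine ⟨_, hj'.next (by rw [List.length_drop]; omega), ?_⟩
      rw [List.drop_drop, ← add_assoc]

theorem IsCutPos.factorLength_le {j : ℕ} (h : IsCutPos l x j) (hj : 0 < j) :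
    factorLength l x ≤ j := by
  rcases h.exists_eq_add with rfl | ⟨-, j', -, rfl⟩
  · exact absurd hj (lt_irrefl 0)
  · exact Nat.le_add_right _ _

theorem mem_cuts_iff (hl : 0 < l) {j : ℕ} :
    j ∈ cuts l x ↔ x ≠ [] ∧ (j = factorLength l x ∨
      ∃ j' ∈ cuts l (x.drop (factorLength l x)), j = factorLength l x + j') := by
  unfold cuts
  rcases eq_or_ne x [] with rfl | hx
  · have h : factorLength l ([] : List A) = 0 := Nat.le_zero.1 (factorLength_le l [])
    rw [factors, if_pos h]
    simp
  · rw [factors, if_neg (factorLength_pos hl hx).ne']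
    have hle := factorLength_le l x
    simp only [Finset.mem_image, Finset.mem_range, List.length_cons, ne_eq, hx, not_false_eq_true,
      true_and]
    constructor
    · rintro ⟨i, hi, rfl⟩
      cases i with
      | zero => exact Or.inl (by simpa using hle)
      | succ i => exact Or.inr ⟨_, ⟨i, by omega, rfl⟩, by simpa using hle⟩
    · rintro (rfl | ⟨_, ⟨i, hi, rfl⟩, rfl⟩)
      · exact ⟨0, by omega, by simpa using hle⟩
      · exact ⟨i + 1, by omega, by simpa using hle⟩

theorem isCutPos_iff_mem_cuts (hl : 0 < l) {j : ℕ} :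
    IsCutPos l x j ↔ j = 0 ∨ j ∈ cuts l x := by
  induction h : x.length using Nat.strong_induction_on generalizing x j with
  | _ n ih =>
    subst h
    rcases eq_or_ne x [] with rfl | hx
    · refine ⟨fun h => Or.inl (Nat.le_zero.1 h.le), ?_⟩
      rintro (rfl | h)
      · exact .zero
      · exact absurd rfl ((mem_cuts_iff hl).1 h).1
    · have hpos := factorLength_pos hl hx
      have hlt : (x.drop (factorLength l x)).length < x.length := by
        have := List.length_pos_iff.2 hx
        rw [List.length_drop]
        omega
      rw [mem_cuts_iff hl]
      constructor
      · intro h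
        rcases h.exists_eq_add with rfl | ⟨-, j', hj', rfl⟩
        · exact Or.inl rfl
        · rcases (ih _ hlt rfl).1 hj' with rfl | hj'
          · exact Or.inr ⟨hx, Or.inl rfl⟩
          · exact Or.inr ⟨hx, Or.inr ⟨j', hj', rfl⟩⟩
      · rintro (rfl | ⟨-, rfl | ⟨j', hj', rfl⟩⟩)
        · exact .zero
        · exact IsCutPos.cons (j := 0) hx .zero
        · exact IsCutPos.cons hx ((ih _ hlt rfl).2 (Or.inr hj'))

end Cuts

/-! ### Finite summaries of words -/

section Summary

variable {A : Type v} {l : ℕ} {x x' : List A}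

/-- Words of length at most `l`. -/
abbrev ShortWord (A : Type v) (l : ℕ) : Type v := {y : List A // y.length ≤ l}

/-- The prefix of length `l` of a word, or the word itself if it is shorter. -/
def shortPrefix (l : ℕ) (x : List A) : ShortWord A l := ⟨x.take l, List.length_take_le l x⟩

/-- The values of `summary`. -/
abbrev Summary (A : Type v) (l : ℕ) : Type v := ShortWord A l × Fin l.factorial × Set (Fin l)

/-- The prefix of length `l` of a word, its length modulo `l!`, which determines its length modulo
every `p ≤ l`, and the set of its periods in `{1, …, l}`, where `p : Fin l` encodes the period
`p + 1`. -/
def summary (l : ℕ) (x : List A) : Summary A l :=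
  (shortPrefix l x, ⟨x.length % l.factorial, Nat.mod_lt _ l.factorial_pos⟩,
    {p | IsPeriod (p + 1) x})

theorem summary_eq_iff : summary l x = summary l x' ↔ x.take l = x'.take l ∧
    x.length % l.factorial = x'.length % l.factorial ∧
    ∀ p, 0 < p → p ≤ l → (IsPeriod p x ↔ IsPeriod p x') := by
  simp only [summary, shortPrefix, Prod.mk.injEq, Subtype.mk.injEq, Fin.mk.injEq, Set.ext_iff,
    Set.mem_ofPred_eq]
  refine and_congr_right fun _ => and_congr_right fun _ => ⟨fun h p hp hpl => ?_, fun h p => ?_⟩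
  · simpa [Nat.sub_add_cancel hp] using h ⟨p - 1, by omega⟩
  · exact h _ (by omega) (by omega)

theorem length_mod_eq_of_summary_eq (h : summary l x = summary l x') {p : ℕ} (hp : 0 < p)
    (hpl : p ≤ l) : x.length % p = x'.length % p := by
  have hdvd : p ∣ l.factorial := Nat.dvd_factorial hp hpl
  rw [← Nat.mod_mod_of_dvd x.length hdvd, ← Nat.mod_mod_of_dvd x'.length hdvd,
    (summary_eq_iff.1 h).2.1]

theorem take_concat_eq_of_take_eq {n : ℕ} (h : x.take n = x'.take n) (a : A) :
    (x ++ [a]).take n = (x' ++ [a]).take n := by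
  have hlen := congrArg List.length h
  rw [List.length_take, List.length_take] at hlen
  rcases lt_or_ge x.length n with hx | hx
  · rw [List.take_of_length_le hx.le, List.take_of_length_le (by omega)] at h
    rw [h]
  · rw [List.take_append_of_le_length hx, List.take_append_of_le_length (by omega), h]

/-- `summary` is a right congruence. -/
theorem summary_concat_eq (h : summary l x = summary l x') (a : A) :
    summary l (x ++ [a]) = summary l (x' ++ [a]) := by
  have h' := summary_eq_iff.1 h
  have ht := take_concat_eq_of_take_eq h'.1 a
  refine summary_eq_iff.2 ⟨ht, ?_, fun p hp hpl => ?_⟩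
  · simp only [List.length_append, List.length_singleton]
    rw [Nat.add_mod, h'.2.1, ← Nat.add_mod]
  -- The period `p` survives iff the new letter repeats the one at position `|x| % p < l`, which is
  -- part of the summary.
  · have hlt : x'.length % p < l := (Nat.mod_lt _ hp).trans_le hpl
    rw [isPeriod_concat, isPeriod_concat, h'.2.2 p hp hpl,
      length_mod_eq_of_summary_eq h hp hpl, ← List.getElem?_take_of_lt (l := x ++ [a]) hlt, ht,
      List.getElem?_take_of_lt hlt]

theorem summary_append_eq (h : summary l x = summary l x') (y : List A) :
    summary l (x ++ y) = summary l (x' ++ y) := by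
  induction y using List.reverseRecOn with
  | nil => simpa using h
  | append_singleton y a ih =>
    rw [← List.append_assoc, ← List.append_assoc]
    exact summary_concat_eq ih a

theorem shortRoot_congr (hl : 0 < l) (h : summary l x = summary l x') :
    ShortRoot l x ↔ ShortRoot l x' := by
  rw [shortRoot_iff hl, shortRoot_iff hl]
  refine exists_congr fun p => and_congr_right fun hp => and_congr_right fun hpl => ?_
  rw [Nat.dvd_iff_mod_eq_zero, Nat.dvd_iff_mod_eq_zero, length_mod_eq_of_summary_eq h hp hpl,
    (summary_eq_iff.1 h).2.2 p hp hpl]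

/-- Words with a short primitive root, such as factors, are determined by their length and their
summary. -/
theorem eq_of_summary_eq (hl : 0 < l) (h : summary l x = summary l x')
    (hlen : x.length = x'.length) (hx : ShortRoot l x) : x = x' := by
  obtain ⟨p, hp, hpl, -, hper⟩ := (shortRoot_iff hl).1 hx
  have h' := summary_eq_iff.1 h
  refine List.ext_getElem? fun i => ?_
  rcases lt_or_ge i x.length with hi | hi
  · have hlt : i % p < l := (Nat.mod_lt _ hp).trans_le hpl
    rw [hper i hi, (h'.2.2 p hp hpl).1 hper i (hlen ▸ hi), ← List.getElem?_take_of_lt hlt, h'.1,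
      List.getElem?_take_of_lt hlt]
  · rw [List.getElem?_eq_none hi, List.getElem?_eq_none (hlen ▸ hi)]

open Classical in
/-- The action of a letter on summaries. -/
noncomputable def advance (τ : Summary A l) (a : A) : Summary A l :=
  if h : ∃ x, summary l x = τ then summary l (h.choose ++ [a]) else τ

theorem advance_summary (x : List A) (a : A) :
    advance (summary l x) a = summary l (x ++ [a]) := by
  have h : ∃ x', summary l x' = summary l x := ⟨x, rfl⟩
  rw [advance, dif_pos h]
  exact summary_concat_eq h.choose_spec a

/-- A factor with summary `τ` ends before the lookahead `y`. -/
def EndsFactor (τ : Summary A l) (y : List A) : Prop :=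
  ∃ x, summary l x = τ ∧ ShortRoot l x ∧ ∀ y', y' <+: y → y' ≠ [] → ¬ ShortRoot l (x ++ y')

theorem endsFactor_summary_iff (hl : 0 < l) (x y : List A) :
    EndsFactor (summary l x) y ↔
      ShortRoot l x ∧ ∀ y', y' <+: y → y' ≠ [] → ¬ ShortRoot l (x ++ y') := by
  refine ⟨?_, fun h => ⟨x, rfl, h⟩⟩
  rintro ⟨x', hx', h, h'⟩
  refine ⟨(shortRoot_congr hl hx').1 h, fun y' hy' hne hroot => h' y' hy' hne ?_⟩
  exact (shortRoot_congr hl (summary_append_eq hx' y')).2 hroot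

/-- The end of a factor is recognized from the summary of the factor and a lookahead of `l`
letters. -/
theorem endsFactor_iff (hl : 0 < l) (x y : List A) (h : x.length ≤ factorLength l (x ++ y)) :
    EndsFactor (summary l x) (y.take l) ↔ x.length = factorLength l (x ++ y) := by
  rw [endsFactor_summary_iff hl]
  have htake : ∀ n, (x ++ y).take (x.length + n) = x ++ y.take n := by simp [List.take_append]
  constructor
  · rintro ⟨-, h'⟩
    by_contra hne
    obtain ⟨n, hn, hnl, hle, hroot⟩ := exists_shortRoot_take_le_add hl
      (lt_of_le_of_ne h hne) (factorLength_le l _) (shortRoot_take_factorLength hl (x ++ y))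
    obtain ⟨n, rfl⟩ := Nat.exists_eq_add_of_lt hn
    rw [add_assoc, htake] at hroot
    refine h' (y.take (n + 1)) (List.take_prefix_take_left (by omega)) ?_ hroot
    rw [List.length_append] at hle
    exact List.length_pos_iff.1 (by rw [List.length_take]; omega)
  · intro h'
    refine ⟨?_, fun y' hy' hne hroot => ?_⟩
    · have := shortRoot_take_factorLength hl (x ++ y)
      rwa [← h', List.take_left'] at this
      rfl
    · obtain ⟨z, rfl⟩ := hy'.trans (List.take_prefix l y)
      have := le_factorLength (l := l) (x := x ++ (y' ++ z)) (n := x.length + y'.length)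
        (by simp) (by rwa [htake, List.take_left'] ; rfl)
      have := List.length_pos_iff.2 hne
      omega

end Summary

/-! ### The factor automaton -/

/-- The zones of a word with a marked factor: the positions before, inside and after this factor. -/
inductive Zone
  | before
  | inside
  | after
  deriving DecidableEq

instance : Fintype Zone where
  elems := {.before, .inside, .after}
  complete z := by cases z <;> simp

/-- The letters before the marked factor. -/
def Zone.isBefore : Zone → Bool
  | before => true
  | _ => false

/-- The letters before the end of the marked factor. -/
def Zone.isNotAfter : Zone → Bool
  | after => false
  | _ => true

section FactorAutomaton

variable {A : Type v} {l : ℕ}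

/-- The summary of the next factor of `x`, if there is one. -/
noncomputable def nextSummary (l : ℕ) (x : List A) : Option (Summary A l) :=
  if x.length = 0 then none else some (summary l (x.take (factorLength l x)))

/-- The marking of the first factor of `x`. -/
noncomputable def markNext (l : ℕ) (x : List A) : List (A × Zone) :=
  (x.take (factorLength l x)).map (·, Zone.inside) ++
    (x.drop (factorLength l x)).map (·, Zone.after)

/-- The marking of the factor of `x` that starts at position `j`. -/
noncomputable def marking (l : ℕ) (x : List A) (j : ℕ) : List (A × Zone) :=
  (x.take j).map (·, Zone.before) ++ markNext l (x.drop j)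

/-- The states of the factor automaton: the current zone, a summary of the part of the current
factor that has been read (of the whole marked factor, in the zone after it), and the next `l`
letters, which are guessed. -/
abbrev FactorState (A : Type v) (l : ℕ) : Type v := Zone × Summary A l × ShortWord A l

/-- The change of zone and summary when the letter `a` is read, where `y` is the lookahead behind
it. At a cut before the marked factor, the automaton may decide that the next factor is the marked
one. -/
def ZoneStep (a : A) (y : List A) : Zone → Summary A l → Zone → Summary A l → Prop
  | .before, τ, z', τ' => EndsFactor (advance τ a) y ∧ z' ≠ .after ∧ τ' = summary l [] ∨
      ¬ EndsFactor (advance τ a) y ∧ z' = .before ∧ τ' = advance τ a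
  | .inside, τ, z', τ' => EndsFactor (advance τ a) y ∧ z' = .after ∧ τ' = advance τ a ∨
      ¬ EndsFactor (advance τ a) y ∧ z' = .inside ∧ τ' = advance τ a
  | .after, τ, z', τ' => z' = .after ∧ τ' = τ

/-- The transitions of the factor automaton. -/
def FactorStep (p : FactorState A l) (b : A × Zone) (q : FactorState A l) : Prop :=
  b.2 = p.1 ∧ p.2.2.1 = (b.1 :: q.2.2.1).take l ∧ ZoneStep b.1 q.2.2.1 p.1 p.2.1 q.1 q.2.1

/-- The initial states of the factor automaton. -/
def FactorStart (p : FactorState A l) : Prop :=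
  p.1 ≠ .after ∧ p.2.1 = summary l []

/-- The final states of the factor automaton, in which `θ` is the summary of the marked factor if
there is one, and `none` if the marked factor is missing at the end of the word. -/
def FactorFinal (θ : Option (Summary A l)) (q : FactorState A l) : Prop :=
  q.2.2.1 = [] ∧ (q.1 = .inside ∧ q.2.1 = summary l [] ∧ θ = none ∨
    q.1 = .after ∧ θ = some q.2.1)

theorem map_fst_map_mk (x : List A) (z : Zone) : (x.map (·, z)).map Prod.fst = x := by
  simp [Function.comp_def]

theorem map_fst_markNext (x : List A) : (markNext l x).map Prod.fst = x := by
  rw [markNext, List.map_append, map_fst_map_mk, map_fst_map_mk, List.take_append_drop]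

theorem map_fst_marking (x : List A) (j : ℕ) : (marking l x j).map Prod.fst = x := by
  rw [marking, List.map_append, map_fst_map_mk, map_fst_markNext, List.take_append_drop]

/-- There is a path to a final state with summary `θ` of the marked factor. -/
def Accepted (p : FactorState A l) (g : List (A × Zone)) (θ : Option (Summary A l)) : Prop :=
  ∃ q, FactorFinal θ q ∧ IsPath FactorStep p g q

theorem accepted_cons {p : FactorState A l} {b : A × Zone} {g : List (A × Zone)}
    {θ : Option (Summary A l)} :
    Accepted p (b :: g) θ ↔ ∃ r, FactorStep p b r ∧ Accepted r g θ := by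
  simp only [Accepted, IsPath]
  grind

theorem accepted_nil {p : FactorState A l} {θ : Option (Summary A l)} :
    Accepted p [] θ ↔ FactorFinal θ p := by
  simp [Accepted, IsPath]

theorem take_cons_take (n : ℕ) (a : A) (x : List A) :
    (a :: x.take n).take n = (a :: x).take n := by
  cases n <;> simp [List.take_take]

/-- On accepted words the guessed lookahead is correct. -/
theorem Accepted.lookahead_eq {p : FactorState A l} {g : List (A × Zone)}
    {θ : Option (Summary A l)} (h : Accepted p g θ) :
    p.2.2 = shortPrefix l (g.map Prod.fst) := by
  refine Subtype.ext ?_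
  change p.2.2.1 = (g.map Prod.fst).take l
  induction g generalizing p with
  | nil => simpa using (accepted_nil.1 h).1
  | cons b g ih =>
    obtain ⟨r, hr, h⟩ := accepted_cons.1 h
    rw [hr.2.1, ih h, List.map_cons, take_cons_take]

theorem accepted_mk_cons {z z₀ : Zone} {τ : Summary A l} {y : ShortWord A l} {a : A}
    {g : List (A × Zone)} {θ : Option (Summary A l)} :
    Accepted (z, τ, y) ((a, z₀) :: g) θ ↔
      z₀ = z ∧ y = shortPrefix l (a :: g.map Prod.fst) ∧ ∃ z' τ',
        ZoneStep a ((g.map Prod.fst).take l) z τ z' τ' ∧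
          Accepted (z', τ', shortPrefix l (g.map Prod.fst)) g θ := by
  rw [accepted_cons]
  constructor
  · rintro ⟨⟨z', τ', y'⟩, ⟨h₁, h₂, h₃⟩, h⟩
    obtain rfl : y' = _ := h.lookahead_eq
    exact ⟨h₁, Subtype.ext (h₂.trans (take_cons_take _ _ _)), z', τ', h₃, h⟩
  · rintro ⟨rfl, rfl, z', τ', h₃, h⟩
    exact ⟨(z', τ', shortPrefix l (g.map Prod.fst)),
      ⟨rfl, (take_cons_take l a (g.map Prod.fst)).symm, h₃⟩, h⟩

theorem accepted_after_iff {τ : Summary A l} {y : ShortWord A l} {g : List (A × Zone)}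
    {θ : Option (Summary A l)} :
    Accepted (.after, τ, y) g θ ↔ y = shortPrefix l (g.map Prod.fst) ∧
      g = (g.map Prod.fst).map (·, Zone.after) ∧ θ = some τ := by
  induction g generalizing y with
  | nil => simp [accepted_nil, FactorFinal, shortPrefix, Subtype.ext_iff]
  | cons b g ih =>
    obtain ⟨a, z₀⟩ := b
    rw [accepted_mk_cons]
    simp only [ZoneStep, List.map_cons, List.cons.injEq, Prod.mk.injEq, true_and]
    constructor
    · rintro ⟨rfl, rfl, _, _, ⟨rfl, rfl⟩, h⟩
      exact ⟨rfl, ⟨rfl, (ih.1 h).2.1⟩, (ih.1 h).2.2⟩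
    · rintro ⟨rfl, ⟨rfl, h⟩, rfl⟩
      exact ⟨rfl, rfl, _, _, ⟨rfl, rfl⟩, ih.2 ⟨rfl, h, rfl⟩⟩

theorem accepted_inside_iff_of_lt (hl : 0 < l) {x : List A} {y : ShortWord A l}
    {g : List (A × Zone)} {θ : Option (Summary A l)}
    (hx : x.length < factorLength l (x ++ g.map Prod.fst)) :
    Accepted (.inside, summary l x, y) g θ ↔ y = shortPrefix l (g.map Prod.fst) ∧
      g = ((g.map Prod.fst).take (factorLength l (x ++ g.map Prod.fst) - x.length)).map
          (·, Zone.inside) ++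
        ((g.map Prod.fst).drop (factorLength l (x ++ g.map Prod.fst) - x.length)).map
          (·, Zone.after) ∧
      θ = some (summary l ((x ++ g.map Prod.fst).take
        (factorLength l (x ++ g.map Prod.fst)))) := by
  induction g generalizing x y with
  | nil =>
    have := factorLength_le l (x ++ [])
    simp only [List.map_nil, List.append_nil] at this hx
    omega
  | cons b g ih =>
    obtain ⟨a, z₀⟩ := b
    have hassoc : x ++ ((a, z₀) :: g).map Prod.fst = (x ++ [a]) ++ g.map Prod.fst := by simp
    rw [hassoc] at hx ⊢
    have hlen : (x ++ [a]).length = x.length + 1 := by simp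
    have hcut := endsFactor_iff hl (x ++ [a]) (g.map Prod.fst) (by omega)
    obtain ⟨n, hn⟩ := Nat.exists_eq_add_of_lt hx
    have hsub : factorLength l (x ++ [a] ++ g.map Prod.fst) - x.length = n + 1 := by omega
    rw [accepted_mk_cons, hsub]
    simp only [ZoneStep, advance_summary, hcut, List.map_cons, List.take_succ_cons,
      List.drop_succ_cons, List.cons_append, List.cons.injEq, Prod.mk.injEq, true_and]
    rcases Nat.eq_zero_or_pos n with rfl | hn0
    · have heq : (x ++ [a]).length = factorLength l (x ++ [a] ++ g.map Prod.fst) := by omega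
      have htake : (x ++ [a] ++ g.map Prod.fst).take
          (factorLength l (x ++ [a] ++ g.map Prod.fst)) = x ++ [a] := by
        rw [← heq, List.take_left]
      rw [htake]
      simp only [heq, not_true_eq_false, false_and, or_false, true_and]
      constructor
      · rintro ⟨rfl, rfl, _, _, ⟨rfl, rfl⟩, h⟩
        obtain ⟨-, h₁, h₂⟩ := accepted_after_iff.1 h
        exact ⟨rfl, ⟨rfl, by simpa using h₁⟩, h₂⟩
      · rintro ⟨rfl, ⟨rfl, h₁⟩, rfl⟩
        exact ⟨rfl, rfl, _, _, ⟨rfl, rfl⟩, accepted_after_iff.2 ⟨rfl, by simpa using h₁, rfl⟩⟩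
    · have hne : (x ++ [a]).length ≠ factorLength l (x ++ [a] ++ g.map Prod.fst) := by omega
      have hsub' : factorLength l (x ++ [a] ++ g.map Prod.fst) - (x ++ [a]).length = n := by omega
      simp only [hne, not_false_eq_true, false_and, false_or, true_and]
      have ih' := fun y => ih (x := x ++ [a]) (y := y) (by omega)
      rw [hsub'] at ih'
      constructor
      · rintro ⟨rfl, rfl, _, _, ⟨rfl, rfl⟩, h⟩
        obtain ⟨-, h₁, h₂⟩ := (ih' _).1 h
        exact ⟨rfl, ⟨rfl, h₁⟩, h₂⟩
      · rintro ⟨rfl, ⟨rfl, h₁⟩, rfl⟩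
        exact ⟨rfl, rfl, _, _, ⟨rfl, rfl⟩, (ih' _).2 ⟨rfl, h₁, rfl⟩⟩

theorem accepted_inside_iff (hl : 0 < l) {y : ShortWord A l} {g : List (A × Zone)}
    {θ : Option (Summary A l)} :
    Accepted (.inside, summary l [], y) g θ ↔ y = shortPrefix l (g.map Prod.fst) ∧
      g = markNext l (g.map Prod.fst) ∧ θ = nextSummary l (g.map Prod.fst) := by
  rcases eq_or_ne g [] with rfl | hg
  · simp [accepted_nil, FactorFinal, shortPrefix, markNext, nextSummary, Subtype.ext_iff]
  · have hpos := factorLength_pos hl (x := g.map Prod.fst) (by simpa using hg)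
    have := accepted_inside_iff_of_lt (x := []) (y := y) (g := g) (θ := θ) hl (by simpa using hpos)
    simpa [markNext, nextSummary, hg] using this

theorem accepted_before_iff_of_lt (hl : 0 < l) {x : List A} {y : ShortWord A l}
    {g : List (A × Zone)} {θ : Option (Summary A l)}
    (hx : x.length < factorLength l (x ++ g.map Prod.fst)) :
    Accepted (.before, summary l x, y) g θ ↔ y = shortPrefix l (g.map Prod.fst) ∧
      ∃ j, 0 < j ∧ IsCutPos l (x ++ g.map Prod.fst) (x.length + j) ∧
        g = marking l (g.map Prod.fst) j ∧ θ = nextSummary l ((g.map Prod.fst).drop j) := by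
  induction g generalizing x y with
  | nil =>
    have := factorLength_le l (x ++ [])
    simp only [List.map_nil, List.append_nil] at this hx
    omega
  | cons b g ih =>
    obtain ⟨a, z₀⟩ := b
    have hassoc : x ++ ((a, z₀) :: g).map Prod.fst = (x ++ [a]) ++ g.map Prod.fst := by simp
    rw [hassoc] at hx ⊢
    have hlen : (x ++ [a]).length = x.length + 1 := by simp
    have hcut := endsFactor_iff hl (x ++ [a]) (g.map Prod.fst) (by omega)
    have hmark : ∀ j, (a, z₀) :: g = marking l (a :: g.map Prod.fst) (j + 1) ↔
        z₀ = .before ∧ g = marking l (g.map Prod.fst) j := by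
      intro j
      simp [marking]
    rw [accepted_mk_cons]
    simp only [ZoneStep, advance_summary, hcut, List.map_cons]
    rcases eq_or_ne (x ++ [a]).length (factorLength l (x ++ [a] ++ g.map Prod.fst)) with heq | hne
    · have hdrop : (x ++ [a] ++ g.map Prod.fst).drop
          (factorLength l (x ++ [a] ++ g.map Prod.fst)) = g.map Prod.fst := by
        rw [← heq, List.drop_left]
      have hcons : ∀ j, IsCutPos l (x ++ [a] ++ g.map Prod.fst) (x.length + (j + 1)) ↔
          IsCutPos l (g.map Prod.fst) j := by
        intro j
        constructor
        · intro h
          obtain h | ⟨-, j', h, h'⟩ := h.exists_eq_add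
          · omega
          · rw [hdrop] at h
            obtain rfl : j = j' := by omega
            exact h
        · intro h
          rw [← hdrop] at h
          have := h.cons (by simp)
          rwa [← heq, hlen, add_assoc, add_comm 1 j] at this
      simp only [heq, not_true_eq_false, false_and, or_false, true_and]
      constructor
      · rintro ⟨rfl, rfl, z', _, ⟨hz', rfl⟩, h⟩
        refine ⟨rfl, ?_⟩
        cases z' with
        | after => exact absurd rfl hz'
        | inside =>
          obtain ⟨-, h₁, h₂⟩ := (accepted_inside_iff hl).1 h
          exact ⟨1, one_pos, (hcons 0).2 .zero, (hmark 0).2 ⟨rfl, by simpa [marking] using h₁⟩, h₂⟩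
        | before =>
          rcases eq_or_ne g [] with rfl | hg
          · simp [accepted_nil, FactorFinal] at h
          · obtain ⟨-, j, -, h₁, h₂, h₃⟩ := (ih (x := []) (by
              simpa using factorLength_pos hl (x := g.map Prod.fst) (by simpa using hg))).1 h
            exact ⟨j + 1, j.succ_pos, (hcons j).2 (by simpa using h₁), (hmark j).2 ⟨rfl, h₂⟩, h₃⟩
      · rintro ⟨rfl, j, hj, h₁, h₂, h₃⟩
        obtain ⟨j, rfl⟩ := Nat.exists_eq_succ_of_ne_zero hj.ne'
        obtain ⟨rfl, h₄⟩ := (hmark j).1 h₂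
        replace h₁ := (hcons j).1 h₁
        refine ⟨rfl, rfl, ?_⟩
        rcases Nat.eq_zero_or_pos j with rfl | hj
        · exact ⟨.inside, _, ⟨by simp, rfl⟩,
            (accepted_inside_iff hl).2 ⟨rfl, by simpa [marking] using h₄, h₃⟩⟩
        · have hg : g.map Prod.fst ≠ [] := by
            have := h₁.le
            exact List.length_pos_iff.1 (by omega)
          exact ⟨.before, _, ⟨by simp, rfl⟩, (ih (x := []) (by
            simpa using factorLength_pos hl hg)).2 ⟨rfl, j, hj, by simpa using h₁, h₄, h₃⟩⟩
    · have ih' := fun y => ih (x := x ++ [a]) (y := y) (by omega)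
      have hadd : ∀ j, (x ++ [a]).length + j = x.length + (j + 1) := by intro j; omega
      simp only [hadd] at ih'
      simp only [hne, not_false_eq_true, false_and, false_or, true_and]
      constructor
      · rintro ⟨rfl, rfl, _, _, ⟨rfl, rfl⟩, h⟩
        obtain ⟨-, j, -, h₁, h₂, h₃⟩ := (ih' _).1 h
        exact ⟨rfl, j + 1, j.succ_pos, h₁, (hmark j).2 ⟨rfl, h₂⟩, h₃⟩
      · rintro ⟨rfl, j, hj, h₁, h₂, h₃⟩
        obtain ⟨j, rfl⟩ := Nat.exists_eq_succ_of_ne_zero hj.ne'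
        obtain ⟨rfl, h₄⟩ := (hmark j).1 h₂
        have := h₁.factorLength_le (by omega)
        exact ⟨rfl, rfl, _, _, ⟨rfl, rfl⟩, (ih' _).2 ⟨rfl, j, by omega, h₁, h₄, h₃⟩⟩

/-- The factor automaton accepts the markings of a factor, or of the end of the word. -/
theorem exists_accepted_iff (hl : 0 < l) {g : List (A × Zone)} {θ : Option (Summary A l)} :
    (∃ p, FactorStart p ∧ Accepted p g θ) ↔ ∃ j, IsCutPos l (g.map Prod.fst) j ∧
      g = marking l (g.map Prod.fst) j ∧ θ = nextSummary l ((g.map Prod.fst).drop j) := by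
  have hbefore : ∀ y, g ≠ [] → _ := fun y hg => accepted_before_iff_of_lt (x := []) (y := y)
    (g := g) (θ := θ) hl (by simpa using factorLength_pos hl (x := g.map Prod.fst) (by simpa))
  simp only [List.nil_append, List.length_nil, zero_add] at hbefore
  constructor
  · rintro ⟨⟨z, _, y⟩, ⟨hz, rfl⟩, h⟩
    cases z with
    | after => exact absurd rfl hz
    | inside =>
      obtain ⟨-, h₁, h₂⟩ := (accepted_inside_iff hl).1 h
      exact ⟨0, .zero, by simpa [marking] using h₁, h₂⟩
    | before =>
      rcases eq_or_ne g [] with rfl | hg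
      · simp [accepted_nil, FactorFinal] at h
      · obtain ⟨-, j, -, h⟩ := (hbefore y hg).1 h
        exact ⟨j, h⟩
  · rintro ⟨j, h₁, h₂, h₃⟩
    rcases Nat.eq_zero_or_pos j with rfl | hj
    · exact ⟨(.inside, _, _), ⟨by simp, rfl⟩,
        (accepted_inside_iff hl).2 ⟨rfl, by simpa [marking] using h₂, h₃⟩⟩
    · have hg : g ≠ [] := by
        rintro rfl
        have := h₁.le
        simp at this
        omega
      exact ⟨(.before, _, _), ⟨by simp, rfl⟩, (hbefore _ hg).2 ⟨rfl, j, hj, h₁, h₂, h₃⟩⟩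

end FactorAutomaton

open Substitution

/-! ### Weights at the ends of a marked factor -/

section Weights

variable {X : Type u} {A : Type v} {O : X} {l : ℕ}

theorem weight_length {j : ℕ} {s : List (Substitution X A)} (hj : j ≤ (output O s).length) :
    weight O j s.length s = j := by
  unfold weight
  rw [List.countP_eq_length.2, List.length_take, min_eq_left (by rwa [length_origins])]
  intro o ho
  exact decide_eq_true (le_length_of_mem_origins (List.mem_of_mem_take ho)).2

theorem weight_zero_right (j : ℕ) (s : List (Substitution X A)) : weight O j 0 s = 0 := by
  unfold weight
  refine List.countP_eq_zero.2 fun o ho => ?_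
  have := (le_length_of_mem_origins (List.mem_of_mem_take ho)).1
  simpa using by omega

theorem weight_zero_left (t : ℕ) (s : List (Substitution X A)) : weight O 0 t s = 0 := by
  simp [weight]

/-- The end of the factor of `x` that starts at position `j`. -/
noncomputable def nextCut (l : ℕ) (x : List A) (j : ℕ) : ℕ :=
  j + factorLength l (x.drop j)

theorem nextCut_le {x : List A} {j : ℕ} (hj : j ≤ x.length) : nextCut l x j ≤ x.length := by
  have := factorLength_le l (x.drop j)
  rw [List.length_drop] at this
  unfold nextCut
  omega

theorem countP_and_eq_countP_take {B : Type*} {P Q : B → Bool} {n : ℕ} {w : List B}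
    (h : ∀ b ∈ w.take n, P b = true) (h' : ∀ b ∈ w.drop n, P b = false) :
    (w.countP fun b => P b && Q b) = (w.take n).countP Q := by
  conv_lhs => rw [← List.take_append_drop n w, List.countP_append]
  rw [List.countP_congr (q := Q) fun b hb => by simp [h b hb],
    List.countP_congr (q := fun _ => false) (l := w.drop n) fun b hb => by simp [h' b hb]]
  simp

/-- A path whose letters in a prefix of length `n` are those that satisfy `P` has the weight of
position `n`. -/
theorem countP_eq_weight {s : List (Substitution X A)} {w : List ((A × Zone) × ℕ)}
    (hw : w.map (Prod.map Prod.fst id) = annotated O s) {P : Zone → Bool} {n : ℕ}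
    (h : ∀ b ∈ (w.map Prod.fst).take n, P b.2 = true)
    (h' : ∀ b ∈ (w.map Prod.fst).drop n, P b.2 = false) (t : ℕ) :
    (w.countP fun g => P g.1.2 && decide (g.2 ≤ t)) = weight O n t s := by
  rw [countP_and_eq_countP_take (n := n)]
  · rw [weight, ← map_snd_annotated, ← hw, List.map_map, ← List.map_take, List.countP_map]
    rfl
  · intro b hb
    exact h b.1 (by rw [← List.map_take]; exact List.mem_map_of_mem hb)
  · intro b hb
    exact h' b.1 (by rw [← List.map_drop]; exact List.mem_map_of_mem hb)

theorem isBefore_of_mem_take_marking {x : List A} {j : ℕ} (hj : j ≤ x.length) :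
    (∀ b ∈ (marking l x j).take j, b.2.isBefore = true) ∧
      ∀ b ∈ (marking l x j).drop j, b.2.isBefore = false := by
  have hlen : ((x.take j).map (·, Zone.before)).length = j := by simpa using hj
  unfold marking
  rw [List.take_left' hlen, List.drop_left' hlen, markNext]
  constructor
  · intro b hb
    obtain ⟨a, -, rfl⟩ := List.mem_map.1 hb
    rfl
  · intro b hb
    rcases List.mem_append.1 hb with hb | hb <;> obtain ⟨a, -, rfl⟩ := List.mem_map.1 hb <;> rfl

theorem isNotAfter_of_mem_take_marking {x : List A} {j : ℕ} (hj : j ≤ x.length) :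
    (∀ b ∈ (marking l x j).take (nextCut l x j), b.2.isNotAfter = true) ∧
      ∀ b ∈ (marking l x j).drop (nextCut l x j), b.2.isNotAfter = false := by
  have hlen : ((x.take j).map (·, Zone.before) ++
      ((x.drop j).take (factorLength l (x.drop j))).map (·, Zone.inside)).length =
        nextCut l x j := by
    have := factorLength_le l (x.drop j)
    rw [List.length_append, List.length_map, List.length_map, List.length_take, List.length_take,
      min_eq_left hj, min_eq_left this, nextCut]
  unfold marking markNext
  rw [← List.append_assoc, List.take_left' hlen, List.drop_left' hlen]
  constructor
  · intro b hb
    rcases List.mem_append.1 hb with hb | hb <;> obtain ⟨a, -, rfl⟩ := List.mem_map.1 hb <;> rfl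
  · intro b hb
    obtain ⟨a, -, rfl⟩ := List.mem_map.1 hb
    rfl

open Classical in
/-- The endpoints of a family of paths in which only `O` survives. -/
noncomputable def onlyEndpoints {Q : Type*} (O : X) (p q : Q) : X → Option (Q × Q) :=
  fun Y => if Y = O then some (p, q) else none

variable [Fintype X]

theorem pathWeight_eq_countP {G : Type*} {w : X → List (G × ℕ)} (hw : ∀ Y, Y ≠ O → w Y = [])
    (P : G → Bool) (t : ℕ) :
    pathWeight P w t = (w O).countP fun g => P g.1 && decide (g.2 ≤ t) := by
  unfold pathWeight
  refine Finset.sum_eq_single O (fun Y _ hY => ?_) (by simp)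
  simp [hw Y hY]

/-- The accepting families of paths of the factor automaton over the output of `s` correspond to the
markings of a factor of the output, and their weights are those of the ends of this factor. -/
theorem exists_realizes_iff (hl : 0 < l) {s : List (Substitution X A)}
    {θ : Option (Summary A l)} {W₀ W₁ : ℕ → ℕ} :
    (∃ p q w, FactorStart p ∧ FactorFinal θ q ∧
      Realizes FactorStep Prod.fst s (onlyEndpoints O p q) w ∧
      W₀ = pathWeight (fun b : A × Zone => b.2.isBefore) w ∧
      W₁ = pathWeight (fun b : A × Zone => b.2.isNotAfter) w) ↔
    ∃ j, IsCutPos l (output O s) j ∧ θ = nextSummary l ((output O s).drop j) ∧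
      W₀ = (fun t => weight O j t s) ∧
      W₁ = fun t => weight O (nextCut l (output O s) j) t s := by
  classical
  have hweights : ∀ (w : X → List ((A × Zone) × ℕ)) (j : ℕ), (∀ Y, Y ≠ O → w Y = []) →
      (w O).map (Prod.map Prod.fst id) = annotated O s → j ≤ (output O s).length →
      (w O).map Prod.fst = marking l (output O s) j →
      pathWeight (fun b : A × Zone => b.2.isBefore) w = (fun t => weight O j t s) ∧
      pathWeight (fun b : A × Zone => b.2.isNotAfter) w =
        fun t => weight O (nextCut l (output O s) j) t s := by
    intro w j hnil hmap hj hmark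
    obtain ⟨h₁, h₂⟩ := isBefore_of_mem_take_marking (l := l) hj
    obtain ⟨h₃, h₄⟩ := isNotAfter_of_mem_take_marking (l := l) hj
    rw [← hmark] at h₁ h₂ h₃ h₄
    refine ⟨funext fun t => ?_, funext fun t => ?_⟩
    · rw [pathWeight_eq_countP hnil, countP_eq_weight hmap h₁ h₂]
    · rw [pathWeight_eq_countP hnil, countP_eq_weight hmap h₃ h₄]
  constructor
  · rintro ⟨p, q, w, hp, hq, hw, rfl, rfl⟩
    have hO : onlyEndpoints O p q O = some (p, q) := by simp [onlyEndpoints]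
    have hnil : ∀ Y, Y ≠ O → w Y = [] := fun Y hY => hw.eq_nil Y (by simp [onlyEndpoints, hY])
    have hfst : ((w O).map Prod.fst).map Prod.fst = output O s := by
      rw [← map_fst_annotated, ← hw.map_eq O p q hO, List.map_map, List.map_map]
      rfl
    obtain ⟨j, h₁, h₂, h₃⟩ := (exists_accepted_iff hl).1 ⟨p, hp, q, hq, hw.isPath O p q hO⟩
    rw [hfst] at h₁ h₂ h₃
    exact ⟨j, h₁, h₃, hweights w j hnil (hw.map_eq O p q hO) h₁.le h₂⟩
  · rintro ⟨j, h₁, rfl, rfl, rfl⟩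
    have hlen : (marking l (output O s) j).length = (origins O s).length := by
      rw [length_origins, ← congrArg List.length (map_fst_marking (output O s) j),
        List.length_map]
    obtain ⟨p, hp, q, hq, hpath⟩ := (exists_accepted_iff hl
      (g := marking l (output O s) j) (θ := nextSummary l ((output O s).drop j))).2
      ⟨j, by rw [map_fst_marking]; exact h₁, by rw [map_fst_marking], by rw [map_fst_marking]⟩
    let w : X → List ((A × Zone) × ℕ) := fun Y =>
      if Y = O then (marking l (output O s) j).zip (origins O s) else []
    have hwO : w O = (marking l (output O s) j).zip (origins O s) := if_pos rfl
    have hnil : ∀ Y, Y ≠ O → w Y = [] := fun Y hY => if_neg hY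
    have hfst : (w O).map Prod.fst = marking l (output O s) j := by
      rw [hwO, List.map_fst_zip hlen.le]
    have hmap : (w O).map (Prod.map Prod.fst id) = annotated O s := by
      rw [hwO, ← List.zip_map, List.map_id, map_fst_marking, ← map_fst_annotated,
        ← map_snd_annotated, List.zip_map']
      exact List.map_id _
    have hpq : ∀ Y p' q', onlyEndpoints O p q Y = some (p', q') → Y = O ∧ p = p' ∧ q = q' := by
      intro Y p' q' h
      by_cases hY : Y = O
      · simpa [onlyEndpoints, hY] using h
      · simp [onlyEndpoints, hY] at h
    obtain ⟨h₂, h₃⟩ := hweights w j hnil hmap h₁.le hfst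
    refine ⟨p, q, w, hp, hq, ⟨fun Y p' q' h => ?_, fun Y p' q' h => ?_, fun Y h => ?_⟩,
      h₂.symm, h₃.symm⟩
    · obtain ⟨rfl, -⟩ := hpq Y p' q' h
      exact hmap
    · obtain ⟨rfl, rfl, rfl⟩ := hpq Y p' q' h
      rw [hfst]
      exact hpath
    · refine hnil Y ?_
      rintro rfl
      simp [onlyEndpoints] at h

end Weights

/-! ### Witnesses of a large delay or of different outputs -/

section Witness

variable {X : Type u} {A : Type v}

/-- A pair of positions witnesses that `s` and `s'` have different outputs or a large delay: the
weights of the positions differ by at most `k` at any time and are finally equal, so that the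
positions are equal, and one of the following holds for the factors that start there. Their
summaries differ, or their ends have different positions, or the weights of their ends differ by
more than `k` at some time. -/
def IsWitness (O : X) (k l : ℕ) (s s' : List (Substitution X A)) (j j' : ℕ) : Prop :=
  (∀ t ≤ s.length, |(weight O j t s : ℤ) - weight O j' t s'| ≤ k) ∧
    (weight O j s.length s : ℤ) - weight O j' s.length s' = 0 ∧
    (nextSummary l ((output O s).drop j) ≠ nextSummary l ((output O s').drop j') ∨
      ¬ ((∀ t ≤ s.length, |(weight O (nextCut l (output O s) j) t s : ℤ) -
          weight O (nextCut l (output O s') j') t s'| ≤ k) ∧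
        (weight O (nextCut l (output O s) j) s.length s : ℤ) -
          weight O (nextCut l (output O s') j') s.length s' = 0))

variable {O : X} {k l : ℕ} {s s' : List (Substitution X A)}

theorem maxDiff_le_iff {j : ℕ} : maxDiff O j s s' ≤ k ↔
    ∀ t ≤ s.length, |(weight O j t s : ℤ) - weight O j t s'| ≤ k := by
  unfold maxDiff weightDiff
  simp only [Finset.sup_le_iff, Finset.mem_Icc, and_imp]
  constructor
  · intro h t ht
    rcases Nat.eq_zero_or_pos t with rfl | ht0
    · simp [weight_zero_right]
    · have := h t ht0 ht
      rw [Int.abs_eq_natAbs]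
      omega
  · intro h t _ ht
    have := h t ht
    rw [Int.abs_eq_natAbs] at this
    omega

theorem eq_nil_or_take_eq_of_nextSummary_eq (hl : 0 < l) {x y : List A}
    (h : nextSummary l x = nextSummary l y) (h' : factorLength l x = factorLength l y) :
    x = [] ∧ y = [] ∨ x ≠ [] ∧ y ≠ [] ∧
      x.take (factorLength l x) = y.take (factorLength l y) := by
  unfold nextSummary at h
  rcases eq_or_ne x [] with rfl | hx <;> rcases eq_or_ne y [] with rfl | hy
  · exact Or.inl ⟨rfl, rfl⟩
  · simp [hy] at h
  · simp [hx] at h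
  · refine Or.inr ⟨hx, hy, eq_of_summary_eq hl (by simpa [hx, hy] using h) ?_
      (shortRoot_take_factorLength hl x)⟩
    rw [List.length_take, List.length_take, min_eq_left (factorLength_le l x),
      min_eq_left (factorLength_le l y), h']

/-- A pair of sequences violates the conditions of the delay resynchronizer if and only if it has a
witness. If there is none, then the factors agree one after the other: a witness at a common cut
could only be avoided by equal next factors with a small delay at their end. -/
theorem exists_isWitness_iff (hl : 0 < l) (hlen : s.length = s'.length) :
    (∃ j j', IsCutPos l (output O s) j ∧ IsCutPos l (output O s') j' ∧
      IsWitness O k l s s' j j') ↔ ¬ (output O s = output O s' ∧ delay O l s s' ≤ k) := by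
  constructor
  · rintro ⟨j, j', hj, hj', -, h₁, h₂⟩ ⟨hout, hdelay⟩
    have hcut : ∀ i, IsCutPos l (output O s) i → ∀ t ≤ s.length,
        |(weight O i t s : ℤ) - weight O i t s'| ≤ k := by
      intro i hi
      rcases (isCutPos_iff_mem_cuts hl).1 hi with rfl | hi
      · simp [weight_zero_left]
      · exact maxDiff_le_iff.1 ((Finset.le_sup (f := fun j => maxDiff O j s s') hi).trans hdelay)
    have hweight : ∀ i ≤ (output O s).length,
        weight O i s.length s = i ∧ weight O i s.length s' = i := by
      intro i hi
      refine ⟨weight_length hi, ?_⟩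
      rw [hlen]
      exact weight_length (hout ▸ hi)
    obtain rfl : j = j' := by
      have h₃ := (hweight j hj.le).1
      have h₄ := (hweight j' (hout ▸ hj'.le)).2
      omega
    rw [← hout] at h₂
    rcases h₂ with h₂ | h₂
    · exact h₂ rfl
    · refine h₂ ⟨hcut _ ?_, ?_⟩
      -- If no factor starts at `j`, then its end is `j` itself.
      · rcases lt_or_ge j (output O s).length with h | h
        · exact hj.next h
        · have : nextCut l (output O s) j = j := by
            have := nextCut_le (l := l) hj.le
            unfold nextCut at this ⊢
            omega
          rwa [this]
      · obtain ⟨h₃, h₄⟩ := hweight _ (nextCut_le (l := l) hj.le)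
        omega
  · intro hD
    by_contra hno
    refine hD ?_
    have hstep : ∀ j, IsCutPos l (output O s) j → IsCutPos l (output O s') j →
        (∀ t ≤ s.length, |(weight O j t s : ℤ) - weight O j t s'| ≤ k) →
        nextSummary l ((output O s).drop j) = nextSummary l ((output O s').drop j) ∧
        nextCut l (output O s) j = nextCut l (output O s') j ∧
        ∀ t ≤ s.length, |(weight O (nextCut l (output O s) j) t s : ℤ) -
          weight O (nextCut l (output O s) j) t s'| ≤ k := by
      intro j hj hj' hk
      have h : ¬ IsWitness O k l s s' j j := fun h => hno ⟨j, j, hj, hj', h⟩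
      have hend : (weight O j s.length s : ℤ) - weight O j s.length s' = 0 := by
        have h₁ := weight_length (O := O) hj.le
        have h₂ := weight_length (O := O) hj'.le
        rw [← hlen] at h₂
        omega
      obtain ⟨h₁, h₂, h₃⟩ :=
        (not_or.1 fun h' => h ⟨hk, hend, h'⟩).imp not_not.1 not_not.1
      have h₄ : nextCut l (output O s) j = nextCut l (output O s') j := by
        have h₄ := weight_length (O := O) (nextCut_le (l := l) hj.le)
        have h₅ := weight_length (O := O) (nextCut_le (l := l) hj'.le)
        rw [← hlen] at h₅
        omega
      refine ⟨h₁, h₄, ?_⟩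
      rwa [← h₄] at h₂
    have key : ∀ j, IsCutPos l (output O s) j → IsCutPos l (output O s') j ∧
        (output O s).take j = (output O s').take j ∧
        ∀ t ≤ s.length, |(weight O j t s : ℤ) - weight O j t s'| ≤ k := by
      intro j hj
      induction hj with
      | zero => exact ⟨.zero, by simp, by simp [weight_zero_left]⟩
      | @next j hj hlt ih =>
        obtain ⟨hj', htake, hk⟩ := ih
        obtain ⟨h₁, h₂, h₃⟩ := hstep j hj hj' hk
        have h₄ : factorLength l ((output O s).drop j) = factorLength l ((output O s').drop j) := by
          unfold nextCut at h₂
          omega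
        rcases eq_nil_or_take_eq_of_nextSummary_eq hl h₁ h₄ with ⟨h, -⟩ | ⟨-, h, h₅⟩
        · rw [List.drop_eq_nil_iff] at h
          omega
        · rw [ne_eq, List.drop_eq_nil_iff, not_le] at h
          refine ⟨?_, ?_, h₃⟩
          · rw [h₄]
            exact hj'.next h
          · rw [List.take_add, List.take_add, htake, h₅, h₄]
    -- The factorization exhausts the output, so that all of it is covered by `key`.
    have hfull : IsCutPos l (output O s) (output O s).length := by
      have : ∀ n j, IsCutPos l (output O s) j → (output O s).length - j = n →
          IsCutPos l (output O s) (output O s).length := by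
        intro n
        induction n using Nat.strong_induction_on with
        | _ n ih =>
          intro j hj hn
          rcases lt_or_ge j (output O s).length with h | h
          · have hpos := factorLength_pos hl (x := (output O s).drop j)
              (by rw [ne_eq, List.drop_eq_nil_iff]; omega)
            exact ih _ (by omega) _ (hj.next h) rfl
          · rwa [← le_antisymm hj.le h]
      exact this _ 0 .zero rfl
    obtain ⟨hfull', htake, hk⟩ := key _ hfull
    obtain ⟨h₁, h₂, -⟩ := hstep _ hfull hfull' hk
    refine ⟨?_, ?_⟩
    · have h₃ : (output O s').drop (output O s).length = [] := by
        rw [List.drop_length] at h₁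
        by_contra h
        rw [nextSummary, nextSummary, if_pos List.length_nil,
          if_neg (by rwa [List.length_eq_zero_iff])] at h₁
        simp at h₁
      rw [List.take_length] at htake
      rw [htake, List.take_of_length_le (List.drop_eq_nil_iff.1 h₃)]
    · refine Finset.sup_le fun j hj => maxDiff_le_iff.2 (key j ?_).2.2
      exact (isCutPos_iff_mem_cuts hl).2 (Or.inr hj)

end Witness

/-! ### Bounded counters -/

/-- A counter with values between `-k` and `k`; the value `none` means that these bounds have been
exceeded before. -/
abbrev Counter (k : ℕ) : Type := Option {z : ℤ // |z| ≤ k}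

namespace Counter

variable {k : ℕ}

/-- Add `d` to a counter. -/
def add (c : Counter k) (d : ℤ) : Counter k :=
  c.bind fun z => if h : |z.1 + d| ≤ k then some ⟨z.1 + d, h⟩ else none

/-- The counter with value zero. -/
def zero (k : ℕ) : Counter k := some ⟨0, by simp⟩

open Classical in
/-- The counter that has followed the values `D 0, …, D n`. -/
noncomputable def track (k : ℕ) (D : ℕ → ℤ) (n : ℕ) : Counter k :=
  if h : ∀ t ≤ n, |D t| ≤ k then some ⟨D n, h n le_rfl⟩ else none

theorem track_succ (D : ℕ → ℤ) (n : ℕ) : track k D (n + 1) =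
    (track k D n).add (D (n + 1) - D n) := by
  unfold track add
  by_cases h : ∀ t ≤ n, |D t| ≤ k
  · by_cases h' : |D (n + 1)| ≤ k
    · rw [dif_pos h, dif_pos]
      · simp [h']
      · intro t ht
        rcases Nat.le_succ_iff.1 ht with ht | rfl
        exacts [h t ht, h']
    · rw [dif_pos h, dif_neg fun h'' => h' (h'' _ le_rfl)]
      simp [h']
  · rw [dif_neg h, dif_neg fun h' => h fun t ht => h' t (by omega)]
    rfl

theorem track_congr {D D' : ℕ → ℤ} {n : ℕ} (h : ∀ t ≤ n, D t = D' t) :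
    track k D n = track k D' n := by
  have : (∀ t ≤ n, |D t| ≤ k) ↔ ∀ t ≤ n, |D' t| ≤ k :=
    forall₂_congr fun t ht => by rw [h t ht]
  simp [track, this, h n le_rfl]

theorem track_eq_zero_iff {D : ℕ → ℤ} {n : ℕ} :
    track k D n = zero k ↔ (∀ t ≤ n, |D t| ≤ k) ∧ D n = 0 := by
  unfold track zero
  split_ifs with h
  · exact ⟨fun e => ⟨h, by simpa using e⟩, fun e => by simp [e.2]⟩
  · exact ⟨fun e => by simp at e, fun e => absurd e.1 h⟩

end Counter

/-! ### The automaton for pairs of sequences -/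

section GuessAutomaton

variable {X : Type u} {A : Type v} {k l : ℕ}

/-- The states of the nondeterministic automaton that searches for a witness: the guessed endpoints
of the paths of the factor automaton on the contents of the variables, for both sequences, and
counters for the weight differences at the start and at the end of the marked factors. -/
abbrev GuessState (X : Type u) (A : Type v) (k l : ℕ) : Type (max u v) :=
  (X → Option (FactorState A l × FactorState A l)) ×
    (X → Option (FactorState A l × FactorState A l)) × Counter k × Counter k

/-- The letters before the marked factor. -/
def beforeLetter (b : A × Zone) : Bool := b.2.isBefore

/-- The letters before the end of the marked factor. -/
def notAfterLetter (b : A × Zone) : Bool := b.2.isNotAfter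

/-- The states that witness different outputs or a large delay. -/
def IsViolating (O : X) (st : GuessState X A k l) : Prop :=
  ∃ p q p' q' θ θ', FactorStart p ∧ FactorFinal θ q ∧ FactorStart p' ∧ FactorFinal θ' q' ∧
    st.1 = onlyEndpoints O p q ∧ st.2.1 = onlyEndpoints O p' q' ∧
    st.2.2.1 = Counter.zero k ∧ (θ ≠ θ' ∨ st.2.2.2 ≠ Counter.zero k)

variable [Fintype X]

/-- The transitions of the nondeterministic automaton. -/
def PairStep (a : Substitution X A × Substitution X A) (st st' : GuessState X A k l) : Prop :=
  ∃ m m', GuessStep FactorStep Prod.fst st.1 a.1 st'.1 m ∧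
    GuessStep FactorStep Prod.fst st.2.1 a.2 st'.2.1 m' ∧
    st'.2.2.1 = st.2.2.1.add (stepWeight beforeLetter m - stepWeight beforeLetter m') ∧
    st'.2.2.2 = st.2.2.2.add (stepWeight notAfterLetter m - stepWeight notAfterLetter m')

/-- The states realized by families of paths over the contents of the variables after `x`. -/
def realizedStates (k l : ℕ) (x : List (Substitution X A × Substitution X A)) :
    Set (GuessState X A k l) :=
  {st | ∃ w w', Realizes FactorStep Prod.fst (x.map Prod.fst) st.1 w ∧
    Realizes FactorStep Prod.fst (x.map Prod.snd) st.2.1 w' ∧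
    st.2.2.1 = Counter.track k
      (fun t => (pathWeight beforeLetter w t : ℤ) - pathWeight beforeLetter w' t) x.length ∧
    st.2.2.2 = Counter.track k
      (fun t => (pathWeight notAfterLetter w t : ℤ) - pathWeight notAfterLetter w' t) x.length}

theorem track_glue {s s' : List (Substitution X A)} {σ σ' : Substitution X A}
    {ρ ρ₁ ρ' ρ'₁ : X → Option (FactorState A l × FactorState A l)}
    {w w' : X → List ((A × Zone) × ℕ)} {m m' : X → List (X ⊕ (A × Zone))}
    (hlen : s'.length = s.length)
    (hw : Realizes FactorStep Prod.fst s ρ w) (hm : GuessStep FactorStep Prod.fst ρ σ ρ₁ m)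
    (hw' : Realizes FactorStep Prod.fst s' ρ' w')
    (hm' : GuessStep FactorStep Prod.fst ρ' σ' ρ'₁ m') (P : A × Zone → Bool) :
    Counter.track k (fun t => (pathWeight P (glue m w s.length) t : ℤ) -
      pathWeight P (glue m' w' s'.length) t) (s.length + 1) =
    (Counter.track k (fun t => (pathWeight P w t : ℤ) - pathWeight P w' t) s.length).add
      (stepWeight P m - stepWeight P m') := by
  rw [Counter.track_succ]
  congr 1
  · refine Counter.track_congr fun t ht => ?_
    rw [pathWeight_glue_of_le hw hm P ht, pathWeight_glue_of_le hw' hm' P (hlen ▸ ht)]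
  · have h₁ := pathWeight_glue_succ hw hm P
    have h₂ := pathWeight_glue_succ hw' hm' P
    have h₃ := pathWeight_glue_of_le hw hm P le_rfl
    have h₄ := pathWeight_glue_of_le hw' hm' P le_rfl
    rw [hlen] at h₂ h₄ ⊢
    omega

theorem mem_realizedStates_concat {x : List (Substitution X A × Substitution X A)}
    {a : Substitution X A × Substitution X A} {st' : GuessState X A k l} :
    st' ∈ realizedStates k l (x ++ [a]) ↔ ∃ st ∈ realizedStates k l x, PairStep a st st' := by
  have hlen₁ : (x.map Prod.fst).length = x.length := List.length_map _
  have hlen₂ : (x.map Prod.snd).length = (x.map Prod.fst).length := by simp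
  have hlen : (x ++ [a]).length = (x.map Prod.fst).length + 1 := by simp
  obtain ⟨ρ₁, ρ'₁, c₁, d₁⟩ := st'
  simp only [realizedStates, PairStep, Set.mem_ofPred_eq, List.map_append, List.map_singleton, hlen,
    ← hlen₁]
  constructor
  · rintro ⟨w₁, w'₁, hw₁, hw'₁, rfl, rfl⟩
    obtain ⟨ρ, w, m, hw, hm, rfl⟩ := hw₁.exists_glue
    obtain ⟨ρ', w', m', hw', hm', rfl⟩ := hw'₁.exists_glue
    exact ⟨(ρ, ρ', _, _), ⟨w, w', hw, hw', rfl, rfl⟩, m, m', hm, hm',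
      track_glue hlen₂ hw hm hw' hm' _, track_glue hlen₂ hw hm hw' hm' _⟩
  · rintro ⟨⟨ρ, ρ', _, _⟩, ⟨w, w', hw, hw', rfl, rfl⟩, m, m', hm, hm', rfl, rfl⟩
    exact ⟨_, _, hw.concat hm, hw'.concat hm', (track_glue hlen₂ hw hm hw' hm' _).symm,
      (track_glue hlen₂ hw hm hw' hm' _).symm⟩

theorem exists_isViolating_iff {O : X} (hl : 0 < l)
    (x : List (Substitution X A × Substitution X A)) :
    (∃ st ∈ realizedStates k l x, IsViolating O st) ↔
      ∃ j j', IsCutPos l (output O (x.map Prod.fst)) j ∧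
        IsCutPos l (output O (x.map Prod.snd)) j' ∧
        IsWitness O k l (x.map Prod.fst) (x.map Prod.snd) j j' := by
  have hlen : (x.map Prod.fst).length = x.length := List.length_map _
  constructor
  · rintro ⟨⟨ρ, ρ', c, d⟩, ⟨w, w', hw, hw', hc, hd⟩,
      p, q, p', q', θ, θ', hp, hq, hp', hq', rfl, rfl, hc', hd'⟩
    obtain ⟨j, h₁, rfl, h₂, h₃⟩ := (exists_realizes_iff hl).1 ⟨p, q, w, hp, hq, hw, rfl, rfl⟩
    obtain ⟨j', h'₁, rfl, h'₂, h'₃⟩ :=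
      (exists_realizes_iff hl).1 ⟨p', q', w', hp', hq', hw', rfl, rfl⟩
    change _ = Counter.track k (fun t => (pathWeight (fun b => b.2.isBefore) w t : ℤ) -
      pathWeight (fun b => b.2.isBefore) w' t) x.length at hc
    change _ = Counter.track k (fun t => (pathWeight (fun b => b.2.isNotAfter) w t : ℤ) -
      pathWeight (fun b => b.2.isNotAfter) w' t) x.length at hd
    rw [h₂, h'₂, ← hlen] at hc
    rw [h₃, h'₃, ← hlen] at hd
    have h₄ := Counter.track_eq_zero_iff.1 (hc.symm.trans hc')
    refine ⟨j, j', h₁, h'₁, h₄.1, h₄.2, hd'.imp_right fun h h' => h ?_⟩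
    exact hd.trans (Counter.track_eq_zero_iff.2 h')
  · rintro ⟨j, j', h₁, h'₁, h₂, h₃, h₄⟩
    obtain ⟨p, q, w, hp, hq, hw, h₅, h₆⟩ :=
      (exists_realizes_iff hl).2 ⟨j, h₁, rfl, rfl, rfl⟩
    obtain ⟨p', q', w', hp', hq', hw', h'₅, h'₆⟩ :=
      (exists_realizes_iff hl).2 ⟨j', h'₁, rfl, rfl, rfl⟩
    refine ⟨(onlyEndpoints O p q, onlyEndpoints O p' q', _, _), ⟨w, w', hw, hw', rfl, rfl⟩,
      p, q, p', q', _, _, hp, hq, hp', hq', rfl, rfl, ?_, h₄.imp_right fun h h' => h ?_⟩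
    · change Counter.track k (fun t => (pathWeight (fun b => b.2.isBefore) w t : ℤ) -
        pathWeight (fun b => b.2.isBefore) w' t) x.length = _
      rw [← h₅, ← h'₅, ← hlen]
      exact Counter.track_eq_zero_iff.2 ⟨h₂, h₃⟩
    · change Counter.track k (fun t => (pathWeight (fun b => b.2.isNotAfter) w t : ℤ) -
        pathWeight (fun b => b.2.isNotAfter) w' t) x.length = _ at h'
      rw [← h₆, ← h'₆, ← hlen] at h'
      exact Counter.track_eq_zero_iff.1 h'

/-- The powerset automaton of the nondeterministic automaton, with complemented acceptance. Its start
set contains the states that guess an empty path for every surviving variable. -/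
def delayDFA (O : X) (k l : ℕ) :
    DFA (Substitution X A × Substitution X A) (Set (GuessState X A k l)) where
  step U a := {st' | ∃ st ∈ U, PairStep a st st'}
  start := realizedStates k l []
  accept := {U | ¬ ∃ st ∈ U, IsViolating O st}

theorem eval_delayDFA (O : X) (x : List (Substitution X A × Substitution X A)) :
    (delayDFA O k l).eval x = realizedStates k l x := by
  induction x using List.reverseRecOn with
  | nil => rfl
  | append_singleton x a ih =>
    rw [DFA.eval_append_singleton, ih]
    exact Set.ext fun st' => mem_realizedStates_concat.symm

theorem mem_accepts_delayDFA {O : X} (hl : 0 < l)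
    {x : List (Substitution X A × Substitution X A)} :
    x ∈ (delayDFA O k l).accepts ↔
      output O (x.map Prod.fst) = output O (x.map Prod.snd) ∧
        delay O l (x.map Prod.fst) (x.map Prod.snd) ≤ k := by
  rw [DFA.mem_accepts, eval_delayDFA]
  change (¬ ∃ st ∈ realizedStates k l x, IsViolating O st) ↔ _
  rw [exists_isViolating_iff hl, exists_isWitness_iff hl (by simp), not_not]

theorem accepts_comap_delayDFA {O : X} (hl : 0 < l) (S : Finset (Substitution X A)) :
    ((delayDFA O k l).comap (Prod.map Subtype.val Subtype.val : S × S → _)).accepts =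
      convolutionLanguage (delayResynchronizer O k l S) := by
  rw [DFA.accepts_comap]
  refine Set.ext fun x => ?_
  change x.map _ ∈ (delayDFA O k l).accepts ↔ ∃ p ∈ delayResynchronizer O k l S, _
  rw [mem_accepts_delayDFA hl, List.map_map, List.map_map]
  have h₁ : (x.map (Prod.fst ∘ Prod.map Subtype.val Subtype.val) : List (Substitution X A)) =
      (x.map Prod.fst).map Subtype.val := by simp
  have h₂ : (x.map (Prod.snd ∘ Prod.map Subtype.val Subtype.val) : List (Substitution X A)) =
      (x.map Prod.snd).map Subtype.val := by simp
  rw [h₁, h₂]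
  constructor
  · rintro ⟨h, h'⟩
    exact ⟨(x.map Prod.fst, x.map Prod.snd), ⟨by simp, h, h'⟩,
      ((List.zip_map' ..).trans (by simp)).symm⟩
  · rintro ⟨⟨y, z⟩, ⟨hlen, h, h'⟩, rfl⟩
    rw [List.map_fst_zip (Nat.le_of_eq hlen), List.map_snd_zip (Nat.le_of_eq hlen.symm)]
    exact ⟨h, h'⟩

end GuessAutomaton

/-! ### The number of states -/

section Card

/-- A short word is determined by its letters at the positions `0, …, l - 1`. -/
theorem injective_getElem?_shortWord (A : Type v) (l : ℕ) :
    Function.Injective fun (y : ShortWord A l) (i : Fin l) => y.1[i.1]? := by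
  intro y z h
  refine Subtype.ext (List.ext_getElem? fun i => ?_)
  rcases lt_or_ge i l with hi | hi
  · exact congrFun h ⟨i, hi⟩
  · rw [List.getElem?_eq_none (y.2.trans hi), List.getElem?_eq_none (z.2.trans hi)]

instance (A : Type v) [Finite A] (l : ℕ) : Finite (ShortWord A l) :=
  Finite.of_injective _ (injective_getElem?_shortWord A l)

theorem setOf_abs_le_eq (k : ℕ) : {z : ℤ | |z| ≤ k} = Finset.Icc (-(k : ℤ)) k := by
  ext z
  simp [abs_le]

instance (k : ℕ) : Finite {z : ℤ // |z| ≤ k} :=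
  Set.Finite.to_subtype (s := {z : ℤ | |z| ≤ k}) (by
    rw [setOf_abs_le_eq]
    exact Finset.finite_toSet _)

theorem card_counter (k : ℕ) : Nat.card (Counter k) = 2 * (k + 1) := by
  have : Nat.card {z : ℤ // |z| ≤ k} = 2 * k + 1 := by
    change Nat.card ↥{z : ℤ | |z| ≤ k} = _
    rw [setOf_abs_le_eq]
    simp
    omega
  rw [Finite.card_option, this]
  omega

instance (X : Type u) [Finite X] (A : Type v) [Finite A] (k l : ℕ) :
    Finite (GuessState X A k l) := by
  have h : Finite (X → Option (FactorState A l × FactorState A l)) := inferInstance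
  have h' : Finite (Counter k × Counter k) := inferInstance
  exact @Finite.instProd _ _ h (@Finite.instProd _ _ h h')

variable (X : Type u) [Fintype X] (A : Type v) [Fintype A] (k l : ℕ)

theorem card_shortWord_le : Nat.card (ShortWord A l) ≤ (Fintype.card A + 2) ^ l := by
  refine (Nat.card_le_card_of_injective _ (injective_getElem?_shortWord A l)).trans ?_
  simp only [Nat.card_eq_fintype_card, Fintype.card_pi, Fintype.card_option, Finset.prod_const,
    Finset.card_univ, Fintype.card_fin]
  exact Nat.pow_le_pow_left (by omega) l

theorem card_factorState_le (hl : 0 < l) :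
    Nat.card (FactorState A l) ≤ (Fintype.card A + 2) ^ (6 * l ^ 2) := by
  have hb : 2 ≤ Fintype.card A + 2 := by omega
  have hw := card_shortWord_le A l
  have hfact : l.factorial ≤ (Fintype.card A + 2) ^ (l ^ 2) := calc
    l.factorial ≤ l ^ l := Nat.factorial_le_pow l
    _ ≤ (2 ^ l) ^ l := Nat.pow_le_pow_left Nat.lt_two_pow_self.le l
    _ = 2 ^ (l ^ 2) := by rw [← pow_mul, sq]
    _ ≤ _ := Nat.pow_le_pow_left hb _
  have hset : Nat.card (Set (Fin l)) ≤ (Fintype.card A + 2) ^ l := by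
    rw [Nat.card_eq_fintype_card, Fintype.card_set, Fintype.card_fin]
    exact Nat.pow_le_pow_left hb l
  have hzone : Nat.card Zone ≤ (Fintype.card A + 2) ^ 2 := by
    have : Nat.card Zone = 3 := by
      rw [Nat.card_eq_fintype_card]
      rfl
    nlinarith
  rw [Nat.card_prod, Nat.card_prod, Nat.card_prod, Nat.card_prod, Nat.card_fin]
  calc _ ≤ (Fintype.card A + 2) ^ 2 * ((Fintype.card A + 2) ^ l *
        ((Fintype.card A + 2) ^ (l ^ 2) * (Fintype.card A + 2) ^ l) *
          (Fintype.card A + 2) ^ l) := by gcongr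
    _ = (Fintype.card A + 2) ^ (2 + (l + (l ^ 2 + l) + l)) := by simp only [pow_add]
    _ ≤ _ := Nat.pow_le_pow_right (by omega) (by nlinarith)

theorem card_guessState_le (hX : 0 < Fintype.card X) (hl : 0 < l) :
    Nat.card (GuessState X A k l) ≤
      (k + 1) ^ 28 * (Fintype.card A + 2) ^ (28 * Fintype.card X * l ^ 3) := by
  have hb : 2 ≤ Fintype.card A + 2 := by omega
  have hl2 : 1 ≤ l ^ 2 := Nat.one_le_pow _ _ hl
  have hq := card_factorState_le A l hl
  have hpairs : Nat.card (Option (FactorState A l × FactorState A l)) ≤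
      (Fintype.card A + 2) ^ (13 * l ^ 2) := by
    rw [Finite.card_option, Nat.card_prod]
    calc _ ≤ (Fintype.card A + 2) ^ (6 * l ^ 2) * (Fintype.card A + 2) ^ (6 * l ^ 2) + 1 := by
          gcongr
      _ = (Fintype.card A + 2) ^ (12 * l ^ 2) + 1 := by rw [← pow_add]; congr 2; ring
      _ ≤ (Fintype.card A + 2) ^ (12 * l ^ 2 + 1) := by
          rw [pow_succ _ (12 * l ^ 2)]
          have := Nat.one_le_pow (12 * l ^ 2) (Fintype.card A + 2) (by omega)
          generalize (Fintype.card A + 2) ^ (12 * l ^ 2) = N at this ⊢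
          nlinarith
      _ ≤ _ := Nat.pow_le_pow_right (by omega) (by omega)
  have hfun : Nat.card (X → Option (FactorState A l × FactorState A l)) ≤
      (Fintype.card A + 2) ^ (13 * l ^ 2 * Fintype.card X) := by
    rw [Nat.card_fun, Nat.card_eq_fintype_card (α := X), pow_mul]
    exact Nat.pow_le_pow_left hpairs _
  have hcounter : Nat.card (Counter k × Counter k) ≤ (k + 1) ^ 2 * (Fintype.card A + 2) ^ 2 := by
    rw [Nat.card_prod, card_counter]
    calc 2 * (k + 1) * (2 * (k + 1)) = (k + 1) ^ 2 * 2 ^ 2 := by ring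
      _ ≤ _ := by gcongr
  rw [Nat.card_prod, Nat.card_prod (X → _)]
  calc _ ≤ (Fintype.card A + 2) ^ (13 * l ^ 2 * Fintype.card X) *
        ((Fintype.card A + 2) ^ (13 * l ^ 2 * Fintype.card X) *
          ((k + 1) ^ 2 * (Fintype.card A + 2) ^ 2)) := by gcongr
    _ = (k + 1) ^ 2 * (Fintype.card A + 2) ^ (26 * (l ^ 2 * Fintype.card X) + 2) := by ring
    _ ≤ _ := by
      refine Nat.mul_le_mul (Nat.pow_le_pow_right (by omega) (by omega))
        (Nat.pow_le_pow_right (by omega) ?_)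
      have h₁ : 1 ≤ l ^ 2 * Fintype.card X := Nat.mul_pos hl2 hX
      have h₂ : l ^ 2 * Fintype.card X ≤ l ^ 3 * Fintype.card X :=
        Nat.mul_le_mul_right _ (Nat.pow_le_pow_right hl (by omega))
      calc _ ≤ 28 * (l ^ 3 * Fintype.card X) := by omega
        _ = _ := by ring

end Card

/-! ### From automata on convolutions to transducers -/

section Transducer

variable {B : Type u} {Q C : Type v}

/-- The letter-to-letter transducer of an automaton on convolutions: the output letter is guessed
and stored in the target state, in the encoding `e` of the letters. -/
noncomputable def DFA.toTransducer (M : DFA (B × B) Q) (e : B ≃ C) :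
    Transducer B (Q × Option C) where
  initial := {p | p = (M.start, none)}
  final := {p | p.1 ∈ M.accept}
  trans := {δ | ∃ b, δ.2.2 = (M.step δ.1.1 (δ.2.1, b), some (e b))}
  out δ := [δ.2.choose]

theorem DFA.toTransducer_letterToLetter (M : DFA (B × B) Q) (e : B ≃ C) :
    (M.toTransducer e).LetterToLetter := fun _ => rfl

theorem DFA.evalFrom_of_run {M : DFA (B × B) Q} {e : B ≃ C} {p q : Q × Option C} {x y : List B}
    (h : (M.toTransducer e).Run p x y q) :
    x.length = y.length ∧ q.1 = M.evalFrom p.1 (x.zip y) := by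
  induction h with
  | nil q => exact ⟨rfl, rfl⟩
  | @cons p q r b x y hδ hr ih =>
    obtain ⟨h₁, h₂⟩ := ih
    have h₃ := congrArg Prod.fst hδ.choose_spec
    change q.1 = M.step p.1 (b, hδ.choose) at h₃
    refine ⟨by simp [h₁, toTransducer], ?_⟩
    rw [h₂, h₃]
    rfl

theorem DFA.exists_run (M : DFA (B × B) Q) (e : B ≃ C) (p : Q × Option C) {x y : List B}
    (h : x.length = y.length) :
    ∃ q, (M.toTransducer e).Run p x y q ∧ q.1 = M.evalFrom p.1 (x.zip y) := by
  induction x generalizing p y with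
  | nil =>
    obtain rfl := List.length_eq_zero_iff.1 h.symm
    exact ⟨p, .nil p, rfl⟩
  | cons a x ih =>
    obtain ⟨b, y, rfl⟩ := List.exists_cons_of_length_eq_add_one h.symm
    obtain ⟨q, hq, hq'⟩ := ih (M.step p.1 (a, b), some (e b)) (y := y) (by simpa using h)
    have hδ : (p, a, (M.step p.1 (a, b), some (e b))) ∈ (M.toTransducer e).trans := ⟨b, rfl⟩
    refine ⟨q, ?_, hq'⟩
    have hout : (M.toTransducer e).out ⟨_, hδ⟩ = [b] := by
      have := congrArg Prod.snd hδ.choose_spec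
      simp only [Option.some.injEq, EmbeddingLike.apply_eq_iff_eq] at this
      exact congrArg (fun b => [b]) this.symm
    have := Transducer.Run.cons hδ hq
    rwa [hout] at this

theorem isLetterToLetterRational_of_accepts {R : Set (List B × List B)} [Finite B]
    (hR : ∀ p ∈ R, p.1.length = p.2.length) {n : ℕ} (M : DFA (B × B) (Fin n))
    (hM : M.accepts = convolutionLanguage R) : IsLetterToLetterRational R := by
  refine ⟨Fin n × Option (Fin (Nat.card B)), inferInstance, M.toTransducer (Finite.equivFin B),
    M.toTransducer_letterToLetter _, Set.ext fun p => ?_⟩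
  have hmem : p.1.length = p.2.length → (p.1.zip p.2 ∈ M.accepts ↔ p ∈ R) := by
    intro hp
    rw [hM]
    refine ⟨fun ⟨r, hr, h⟩ => ?_, fun h => ⟨p, h, rfl⟩⟩
    have hr' := hR r hr
    have h₁ := congrArg (List.map Prod.fst) h
    have h₂ := congrArg (List.map Prod.snd) h
    rw [List.map_fst_zip hp.le, List.map_fst_zip hr'.le] at h₁
    rw [List.map_snd_zip hp.ge, List.map_snd_zip hr'.ge] at h₂
    rwa [Prod.ext h₁ h₂]
  constructor
  · rintro ⟨_, rfl, q, hq, h⟩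
    obtain ⟨h₁, h₂⟩ := DFA.evalFrom_of_run h
    refine (hmem h₁).1 ?_
    change q.1 ∈ M.accept at hq
    rw [h₂] at hq
    exact hq
  · intro hp
    obtain ⟨q, h, hq⟩ := M.exists_run (Finite.equivFin B) (M.start, none) (hR p hp)
    refine ⟨_, rfl, q, ?_, h⟩
    have := (hmem (hR p hp)).2 hp
    change q.1 ∈ M.accept
    rw [hq]
    exact this

end Transducer

theorem mainTheorem1 :
    ∃ c : ℕ, ∀ (X : Type u) [Fintype X] (A : Type v) [Fintype A] (O : X) (k l : ℕ), 0 < l →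
      ∀ S : Finset (Substitution X A),
        IsLetterToLetterRational (delayResynchronizer O k l S) ∧
        (convolutionLanguage (delayResynchronizer O k l S)).IsRegular ∧
        ∃ (n : ℕ) (M : DFA (S × S) (Fin n)),
          M.accepts = convolutionLanguage (delayResynchronizer O k l S) ∧
          n ≤ 2 ^ ((k + 1) ^ c *
            (Fintype.card A + 2) ^ (c * Fintype.card X * l ^ 3)) := by
  refine ⟨28, fun X _ A _ O k l hl S => ?_⟩
  have hX : 0 < Fintype.card X := Fintype.card_pos_iff.2 ⟨O⟩
  let e := Finite.equivFin (Set (GuessState X A k l))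
  let M : DFA (S × S) (Fin (Nat.card (Set (GuessState X A k l)))) :=
    DFA.reindex e ((delayDFA O k l).comap (Prod.map Subtype.val Subtype.val))
  have hM : M.accepts = convolutionLanguage (delayResynchronizer O k l S) :=
    (DFA.accepts_reindex ..).trans (accepts_comap_delayDFA hl S)
  refine ⟨isLetterToLetterRational_of_accepts (fun p hp => hp.1) M hM, ⟨_, inferInstance, M, hM⟩,
    _, M, hM, ?_⟩
  have hcard : Nat.card (Set (GuessState X A k l)) = 2 ^ Nat.card (GuessState X A k l) := by
    rw [Set, Nat.card_fun]
    simp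
  rw [hcard]
  exact Nat.pow_le_pow_right two_pos (card_guessState_le X A k l hX hl)
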